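/- For real $\alpha,\beta$ let $\mathcal F_{\alpha\beta}$ denote the equation $u_t+xu_y=|x-\alpha|^\beta u_{xx}$ for a function $u=u(t,x,y)$, and let $\mathcal F'_\beta$ denote the equation $u_t+xu_y=|x|^\beta u_{xx}$. A point transformation is a $C^\infty$ diffeomorphism $\Phi$ from a nonempty open subset of the space $\mathbb R^4$ with coordinates $(t,x,y,u)$ onto an open subset of $\mathbb R^4$. It maps an equation $\mathcal L$ to an equation $\tilde{\mathcal L}$ if, wherever its second prolongation is defined, this prolongation sends a 2-jet to a point of $\tilde{\mathcal L}$ exactly when that 2-jet is a point of $\mathcal L$; here the equations are regarded as subsets of the second-order jet space. Two equations are similar if some point transformation maps the first to the second. The equivalence groupoid $\mathcal G^\sim_{\mathcal F}$ of the class $\mathcal F=\{\mathcal F_{\alpha\beta}\}$ is the set of admissible transformations $\big((\alpha,\beta),\Phi,(\tilde\alpha,\tilde\beta)\big)$, where $\Phi$ is a point transformation that maps $\mathcal F_{\alpha\beta}$ to $\mathcal F_{\tilde\alpha\tilde\beta}$; similarly, $\mathcal G^\sim_{\mathcal F'}$ is the set of triples $(\beta,\Phi,\tilde\beta)$, where $\Phi$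 maps $\mathcal F'_\beta$ to $\mathcal F'_{\tilde\beta}$. Identify $(\beta,\Phi,\tilde\beta)\in\mathcal G^\sim_{\mathcal F'}$ with $\big((0,\beta),\Phi,(0,\tilde\beta)\big)$. For $c\in\mathbb R$ let $S(c)\colon(t,x,y,u)\mapsto(t,x+c,y+ct,u)$. (i) For $\beta\ne\tilde\beta$, the equations $\mathcal F'_\beta$ and $\mathcal F'_{\tilde\beta}$ are similar with respect to point transformations if and only if $\beta+\tilde\beta=5$. (ii) The equations $\mathcal F_{\alpha\beta}$ and $\mathcal F_{\tilde\alpha\tilde\beta}$ are similar with respect to point transformations if and only if $\tilde\beta=\beta$ or $\beta+\tilde\beta=5$. (iii) The groupoid $\mathcal G^\sim_{\mathcal F}$ is generated, under inversion and composition (of composable transformations, on the natural domain of the composition, when this domain is nonempty), by the triples $\big((\alpha,\beta),S(-\alpha),(0,\beta)\big)$, $\alpha,\beta\in\mathbb R$, and the elements of $\mathcal G^\sim_{\mathcal F'}$. More specifically, for each $\big((\alpha,\beta),\Phi,(\tilde\alpha,\tilde\beta)\big)\in\mathcal G^\sim_{\mathcal F}$ there is a point transformation $\breve\Phi$ with $(\beta,\breve\Phi,\tilde\beta)\in\mathcal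 G^\sim_{\mathcal F'}$ and $\Phi=S(\tilde\alpha)\circ\breve\Phi\circ S(-\alpha)$. -/

import Mathlib

open Set Filter Topology
open scoped ContDiff

namespace Kolmogorov

/-- The space of the independent variables `(t, x, y)`. -/
abbrev Base : Type := ℝ × ℝ × ℝ

/-- The space of all variables `((t, x, y), u)`. -/
abbrev Total : Type := Base × ℝ

/-- Partial derivative in `t`. -/
noncomputable def dt (f : Base → ℝ) (p : Base) : ℝ :=
  deriv (fun s => f (s, p.2.1, p.2.2)) p.1

/-- Partial derivative in `x`. -/
noncomputable def dx (f : Base → ℝ) (p : Base) : ℝ :=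
  deriv (fun s => f (p.1, s, p.2.2)) p.2.1

/-- Partial derivative in `y`. -/
noncomputable def dy (f : Base → ℝ) (p : Base) : ℝ :=
  deriv (fun s => f (p.1, p.2.1, s)) p.2.2

/-- The second-order jet space of functions `u` of `(t, x, y)`, in its standard coordinates. -/
@[ext] structure Jet2 where
  t : ℝ
  x : ℝ
  y : ℝ
  u : ℝ
  ut : ℝ
  ux : ℝ
  uy : ℝ
  utt : ℝ
  utx : ℝ
  uty : ℝ
  uxx : ℝ
  uxy : ℝ
  uyy : ℝ

/-- The second-order jet of `f` at `p`. -/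
noncomputable def jet2 (f : Base → ℝ) (p : Base) : Jet2 where
  t := p.1
  x := p.2.1
  y := p.2.2
  u := f p
  ut := dt f p
  ux := dx f p
  uy := dy f p
  utt := dt (dt f) p
  utx := dt (dx f) p
  uty := dt (dy f) p
  uxx := dx (dx f) p
  uxy := dx (dy f) p
  uyy := dy (dy f) p

/-- The equation `u_t + x u_y = |x - α| ^ β u_xx`, as a subset of the jet space. For `β < 0` the
coefficient `|x - α| ^ β` is undefined at `x = α`, and there are no points of the equation there. -/
def eqF (θ : ℝ × ℝ) : Set Jet2 :=
  {j | (j.x ≠ θ.1 ∨ 0 ≤ θ.2) ∧ j.ut + j.x * j.uy = |j.x - θ.1| ^ θ.2 * j.uxx}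

/-- The equation `u_t + x u_y = |x| ^ β u_xx`, as a subset of the jet space. -/
def eqF' (β : ℝ) : Set Jet2 :=
  {j | (j.x ≠ 0 ∨ 0 ≤ β) ∧ j.ut + j.x * j.uy = |j.x| ^ β * j.uxx}

/-- Local transformations of the space of all variables, with their (open) domains and ranges. -/
abbrev Trans : Type := OpenPartialHomeomorph Total Total

/-- A point transformation: a local diffeomorphism of class `C^∞` with a nonempty domain. -/
def IsPointTransformation (Φ : Trans) : Prop :=
  Φ.source.Nonempty ∧ ContDiffOn ℝ ∞ Φ Φ.source ∧ ContDiffOn ℝ ∞ Φ.symm Φ.target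

/-- The second prolongation of `Φ`: it sends the jet of `f` at `p` to the jet, at the base point
of `Φ (p, f p)`, of the function `g` whose graph is the image under `Φ` of the graph of `f`
(near these points; the prolongation is undefined at the jets for which that image is not the
graph of a smooth function). -/
def ProlongsTo (Φ : Trans) (j k : Jet2) : Prop :=
  ∃ (f g : Base → ℝ) (p : Base),
    ContDiffAt ℝ ∞ f p ∧ (p, f p) ∈ Φ.source ∧ ContDiffAt ℝ ∞ g (Φ (p, f p)).1 ∧
    (∀ᶠ q in 𝓝 p, (Φ (q, f q)).2 = g (Φ (q, f q)).1) ∧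
    j = jet2 f p ∧ k = jet2 g (Φ (p, f p)).1

/-- `Φ` pushes the equation `L` forward to the equation `M`. -/
def MapsEquation (Φ : Trans) (L M : Set Jet2) : Prop :=
  ∀ j k : Jet2, ProlongsTo Φ j k → (j ∈ L ↔ k ∈ M)

/-- The equivalence groupoid of a class of equations: the set of its admissible transformations
`(θ, Φ, θ')`, where `Φ` is a point transformation that maps the equation with the
arbitrary element `θ` to the one with the arbitrary element `θ'`. -/
def equivalenceGroupoid {ι : Type} (E : ι → Set Jet2) : Set (ι × Trans × ι) :=
  {A | IsPointTransformation A.2.1 ∧ MapsEquation A.2.1 (E A.1) (E A.2.2)}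

/-- Similarity with respect to point transformations. -/
def Similar (L M : Set Jet2) : Prop :=
  ∃ Φ : Trans, IsPointTransformation Φ ∧ MapsEquation Φ L M

/-- The point transformation `(t, x, y, u) ↦ (t, x + c, y + c t, u)`. -/
noncomputable def shift (c : ℝ) : Trans :=
  Homeomorph.toOpenPartialHomeomorph
    { toFun := fun z => ((z.1.1, z.1.2.1 + c, z.1.2.2 + c * z.1.1), z.2)
      invFun := fun z => ((z.1.1, z.1.2.1 - c, z.1.2.2 - c * z.1.1), z.2)
      left_inv := fun z => by simp
      right_inv := fun z => by simp
      continuous_toFun := by fun_prop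
      continuous_invFun := by fun_prop }

/-- The admissible transformations `((α, β), shift (-α), (0, β))`. -/
def shiftArrows : Set ((ℝ × ℝ) × Trans × (ℝ × ℝ)) :=
  {A | ∃ α β : ℝ, A = ((α, β), shift (-α), (0, β))}

/-- The embedding of triples `(β, Φ, β')` as triples `((0, β), Φ, (0, β'))`. -/
def embed (A : ℝ × Trans × ℝ) : (ℝ × ℝ) × Trans × (ℝ × ℝ) :=
  ((0, A.1), A.2.1, (0, A.2.2))

/-- The groupoid generated by a set of triples: its closure under inversion and under composition
(of composable triples, when the composition has a nonempty domain). `Φ.trans Ψ` is `Ψ ∘ Φ` on its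
natural domain. -/
inductive Generated {ι : Type} (G : Set (ι × Trans × ι)) : ι × Trans × ι → Prop
  | of {A : ι × Trans × ι} (h : A ∈ G) : Generated G A
  | inv {a b : ι} {Φ : Trans} (h : Generated G (a, Φ, b)) : Generated G (b, Φ.symm, a)
  | comp {a b c : ι} {Φ Ψ : Trans} (h : Generated G (a, Φ, b)) (h' : Generated G (b, Ψ, c))
      (hne : (Φ.trans Ψ).source.Nonempty) : Generated G (a, Φ.trans Ψ, c)

end Kolmogorov

namespace Kolmogorov

/-! Write the image of `(t, x, y, u)` as `(T, X, Y, U)`. For sufficiency, `shift c` carries `∂_t + x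
∂_y` to the operator of the same form and moves the singular line from `α` to `α + c`, and
`inversion` turns `β` into `5 - β`: `u = x g(y, 1/x, t)` gives `u_xx = x⁻³ g_XX`, and the
first-order part acquires the factor `x²`.

For necessity, the equation is tested on jets of quadratic polynomials at nonsingular points. The
source equation leaves the second derivatives other than `u_xx` free, so they cannot enter the image
equation; this forces `T` and `Y` to depend on `(t, y)` only. Comparing coefficients in `u_t` and
`u_y`, and then varying `u_x`, yields `X_u = 0` and, with `P = T_t + x T_y` and `N = Y_t + x Y_y`,
the relations `N = X P` and `|x - α|^β X_x² = |X - α'|^β' P` (`MapsEquation.determining`).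

When `α = α' = 0`, fix `t, y, u`. Then `P` and `N` are affine in `x` with constant coefficients and
`X = N / P` is fractional linear. The logarithmic derivative of the last relation becomes a
polynomial identity of degree two in `x`, whose coefficients leave only `β' = β` or `β + β' = 5`
(`exponents_of_ode`).

The shifts reduce arbitrary `α, α'` to zero by conjugation (`exists_gauged`), which gives the
factorization and the generation of the groupoid. Closure under composition uses that admissible
transformations are projectable (`MapsEquation.projectable`). -/

theorem two_le_infty : (2 : WithTop ℕ∞) ≤ ∞ := by
  exact WithTop.coe_le_coe.2 (le_top : (2 : ℕ∞) ≤ ⊤)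

/-! ### Second-order chain rules. -/

section Calculus

variable {E F G : Type*} [NormedAddCommGroup E] [NormedSpace ℝ E] [NormedAddCommGroup F]
  [NormedSpace ℝ F] [NormedAddCommGroup G] [NormedSpace ℝ G]

/-- The derivative of a function smooth at a point is differentiable there. -/
theorem differentiableAt_fderiv {f : E → F} {p : E} (hf : ContDiffAt ℝ 2 f p) :
    DifferentiableAt ℝ (fderiv ℝ f) p :=
  (hf.fderiv_right (m := 1) (by norm_num)).differentiableAt (by norm_num)

theorem eventually_differentiableAt {f : E → F} {p : E} (hf : ContDiffAt ℝ 2 f p) :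
    ∀ᶠ q in 𝓝 p, DifferentiableAt ℝ f q :=
  (hf.eventually (by norm_num)).mono fun _ h => h.differentiableAt (by norm_num)

/-- The chain rule for second derivatives. -/
theorem fderiv_fderiv_comp {g : F → G} {h : E → F} {p : E} (hg : ContDiffAt ℝ 2 g (h p))
    (hh : ContDiffAt ℝ 2 h p) (v w : E) :
    fderiv ℝ (fderiv ℝ (g ∘ h)) p v w =
      fderiv ℝ (fderiv ℝ g) (h p) (fderiv ℝ h p v) (fderiv ℝ h p w) +
        fderiv ℝ g (h p) (fderiv ℝ (fderiv ℝ h) p v w) := by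
  have e : fderiv ℝ (g ∘ h) =ᶠ[𝓝 p] fun q => (fderiv ℝ g (h q)).comp (fderiv ℝ h q) := by
    filter_upwards [eventually_differentiableAt hh,
      hh.continuousAt.eventually (eventually_differentiableAt hg)] with q h1 h2
    exact fderiv_comp q h2 h1
  have h1 : HasFDerivAt (fun q => fderiv ℝ g (h q))
      ((fderiv ℝ (fderiv ℝ g) (h p)).comp (fderiv ℝ h p)) p :=
    (differentiableAt_fderiv hg).hasFDerivAt.comp p
      (hh.differentiableAt (by norm_num)).hasFDerivAt
  have h2 := h1.clm_comp (differentiableAt_fderiv hh).hasFDerivAt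
  rw [e.fderiv_eq, h2.fderiv]
  simp [add_comm]

theorem fderiv_fderiv_clm_comp (A : F →L[ℝ] G) {h : E → F} {p : E} (hh : ContDiffAt ℝ 2 h p)
    (v w : E) :
    fderiv ℝ (fderiv ℝ (fun q => A (h q))) p v w = A (fderiv ℝ (fderiv ℝ h) p v w) := by
  have e : fderiv ℝ (fun q => A (h q)) =ᶠ[𝓝 p] fun q => A.comp (fderiv ℝ h q) := by
    filter_upwards [eventually_differentiableAt hh] with q h1
    exact (A.hasFDerivAt.comp q h1.hasFDerivAt).fderiv
  have h2 := (hasFDerivAt_const A p).clm_comp (differentiableAt_fderiv hh).hasFDerivAt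
  rw [e.fderiv_eq, h2.fderiv]
  simp

/-- The derivative of `q ↦ (q, f q)`. -/
theorem hasFDerivAt_graph {f : E → F} {p : E} (hf : DifferentiableAt ℝ f p) :
    HasFDerivAt (fun q => (q, f q)) ((ContinuousLinearMap.id ℝ E).prod (fderiv ℝ f p)) p :=
  (hasFDerivAt_id p).prodMk hf.hasFDerivAt

theorem fderiv_fderiv_graph {f : E → F} {p : E} (hf : ContDiffAt ℝ 2 f p) (v w : E) :
    fderiv ℝ (fderiv ℝ (fun q => (q, f q))) p v w = (0, fderiv ℝ (fderiv ℝ f) p v w) := by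
  have e : fderiv ℝ (fun q => (q, f q)) =ᶠ[𝓝 p] fun q => ContinuousLinearMap.inl ℝ E F +
      (ContinuousLinearMap.inr ℝ E F).comp (fderiv ℝ f q) := by
    filter_upwards [eventually_differentiableAt hf] with q h1
    rw [(hasFDerivAt_graph h1).fderiv]
    ext <;> simp
  have h2 := ((hasFDerivAt_const (ContinuousLinearMap.inr ℝ E F) p).clm_comp
    (differentiableAt_fderiv hf).hasFDerivAt).const_add (ContinuousLinearMap.inl ℝ E F)
  rw [e.fderiv_eq, h2.fderiv]
  simp

end Calculus

/-! ### Partial derivatives through Fréchet derivatives. -/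

section Partial

theorem dt_eq {f : Base → ℝ} {p : Base} (h : DifferentiableAt ℝ f p) :
    dt f p = fderiv ℝ f p (1, 0, 0) :=
  (HasFDerivAt.comp_hasDerivAt (f := fun s => ((s, p.2.1, p.2.2) : Base)) p.1 h.hasFDerivAt
    ((hasDerivAt_id p.1).prodMk ((hasDerivAt_const _ _).prodMk (hasDerivAt_const _ _)))).deriv

theorem hasDerivAt_x (p : Base) :
    HasDerivAt (fun s => ((p.1, s, p.2.2) : Base)) (0, 1, 0) p.2.1 :=
  (hasDerivAt_const _ _).prodMk ((hasDerivAt_id _).prodMk (hasDerivAt_const _ _))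

theorem dx_eq {f : Base → ℝ} {p : Base} (h : DifferentiableAt ℝ f p) :
    dx f p = fderiv ℝ f p (0, 1, 0) :=
  (HasFDerivAt.comp_hasDerivAt (f := fun s => ((p.1, s, p.2.2) : Base)) p.2.1 h.hasFDerivAt
    (hasDerivAt_x p)).deriv

theorem dy_eq {f : Base → ℝ} {p : Base} (h : DifferentiableAt ℝ f p) :
    dy f p = fderiv ℝ f p (0, 0, 1) :=
  (HasFDerivAt.comp_hasDerivAt (f := fun s => ((p.1, p.2.1, s) : Base)) p.2.2 h.hasFDerivAt
    ((hasDerivAt_const _ _).prodMk ((hasDerivAt_const _ _).prodMk (hasDerivAt_id _)))).deriv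

theorem dx_congr {f g : Base → ℝ} {p : Base} (h : f =ᶠ[𝓝 p] g) : dx f p = dx g p :=
  EventuallyEq.deriv_eq ((hasDerivAt_x p).continuousAt.eventually h)

theorem dx_dx_eq {f : Base → ℝ} {p : Base} (h : ContDiffAt ℝ 2 f p) :
    dx (dx f) p = fderiv ℝ (fderiv ℝ f) p (0, 1, 0) (0, 1, 0) := by
  have e : dx f =ᶠ[𝓝 p] fun q => fderiv ℝ f q (0, 1, 0) :=
    (eventually_differentiableAt h).mono fun q hq => dx_eq hq
  have h2 := (differentiableAt_fderiv h).hasFDerivAt.clm_apply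
    (hasFDerivAt_const ((0, 1, 0) : Base) p)
  rw [dx_congr e, dx_eq h2.differentiableAt, h2.fderiv]
  simp

/-- The equation at the jet of a smooth function, in terms of Fréchet derivatives. -/
theorem jet2_mem_eqF {f : Base → ℝ} {p : Base} (h : ContDiffAt ℝ ∞ f p) (θ : ℝ × ℝ) :
    jet2 f p ∈ eqF θ ↔ (p.2.1 ≠ θ.1 ∨ 0 ≤ θ.2) ∧
      fderiv ℝ f p (1, 0, 0) + p.2.1 * fderiv ℝ f p (0, 0, 1) =
        |p.2.1 - θ.1| ^ θ.2 * fderiv ℝ (fderiv ℝ f) p (0, 1, 0) (0, 1, 0) := by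
  have h2 : ContDiffAt ℝ 2 f p := h.of_le two_le_infty
  have h1 : DifferentiableAt ℝ f p := h2.differentiableAt (by norm_num)
  rw [← dt_eq h1, ← dy_eq h1, ← dx_dx_eq h2]
  rfl

end Partial

/-! ### Point transformations acting on graphs and their derivatives. -/

section Prolongation

theorem IsPointTransformation.contDiffAt {Φ : Trans} (hΦ : IsPointTransformation Φ) {z : Total}
    (hz : z ∈ Φ.source) : ContDiffAt ℝ ∞ Φ z :=
  hΦ.2.1.contDiffAt (Φ.open_source.mem_nhds hz)

theorem IsPointTransformation.symm {Φ : Trans} (hΦ : IsPointTransformation Φ) :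
    IsPointTransformation Φ.symm := by
  obtain ⟨⟨z, hz⟩, h1, h2⟩ := hΦ
  exact ⟨⟨Φ z, Φ.map_source hz⟩, h2, h1⟩

theorem IsPointTransformation.trans {Φ Ψ : Trans} (hΦ : IsPointTransformation Φ)
    (hΨ : IsPointTransformation Ψ) (hne : (Φ.trans Ψ).source.Nonempty) :
    IsPointTransformation (Φ.trans Ψ) := by
  refine ⟨hne, ?_, ?_⟩
  · exact hΨ.2.1.comp (hΦ.2.1.mono fun z hz => hz.1) fun z hz => hz.2
  · exact hΦ.2.2.comp (hΨ.2.2.mono fun z hz => hz.1) fun z hz => hz.2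

theorem IsPointTransformation.fderiv_symm_fderiv {Φ : Trans} (hΦ : IsPointTransformation Φ)
    {z : Total} (hz : z ∈ Φ.source) (v : Total) :
    fderiv ℝ Φ.symm (Φ z) (fderiv ℝ Φ z v) = v := by
  have h1 := ((hΦ.contDiffAt hz).differentiableAt (by simp)).hasFDerivAt
  have h2 := ((hΦ.symm.contDiffAt (Φ.map_source hz)).differentiableAt (by simp)).hasFDerivAt
  have h3 := h2.comp z h1
  have h4 : Φ.symm ∘ Φ =ᶠ[𝓝 z] id :=
    Filter.mem_of_superset (Φ.open_source.mem_nhds hz) fun w hw => Φ.left_inv hw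
  have h5 := h3.unique ((hasFDerivAt_id z).congr_of_eventuallyEq h4)
  exact DFunLike.congr_fun h5 v

theorem IsPointTransformation.fderiv_injective {Φ : Trans} (hΦ : IsPointTransformation Φ)
    {z : Total} (hz : z ∈ Φ.source) : Function.Injective (fderiv ℝ Φ z) :=
  (Function.LeftInverse.injective (hΦ.fderiv_symm_fderiv hz))

theorem IsPointTransformation.fderiv_surjective {Φ : Trans} (hΦ : IsPointTransformation Φ)
    {z : Total} (hz : z ∈ Φ.source) : Function.Surjective (fderiv ℝ Φ z) :=
  (LinearMap.injective_iff_surjective (f := (fderiv ℝ Φ z).toLinearMap)).1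
    (hΦ.fderiv_injective hz)

/-- First and second derivatives of a point transformation along the graph of a function. -/
theorem fderiv_along_graph {Φ : Trans} {f : Base → ℝ} {p : Base}
    (hf : ContDiffAt ℝ 2 f p) (hs : ContDiffAt ℝ 2 Φ (p, f p)) (v w : Base) :
    fderiv ℝ (fun q => Φ (q, f q)) p v = fderiv ℝ Φ (p, f p) (v, fderiv ℝ f p v) ∧
    fderiv ℝ (fderiv ℝ (fun q => Φ (q, f q))) p v w =
      fderiv ℝ (fderiv ℝ Φ) (p, f p) (v, fderiv ℝ f p v) (w, fderiv ℝ f p w) +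
        fderiv ℝ (fderiv ℝ f) p v w • fderiv ℝ Φ (p, f p) (0, 1) := by
  have h1 : DifferentiableAt ℝ f p := hf.differentiableAt (by norm_num)
  have hg := hasFDerivAt_graph h1
  have hk : ContDiffAt ℝ 2 (fun q => (q, f q)) p := contDiffAt_id.prodMk hf
  constructor
  · have := (HasFDerivAt.comp p (hs.differentiableAt (by norm_num)).hasFDerivAt hg).fderiv
    exact DFunLike.congr_fun this v
  · have := fderiv_fderiv_comp (h := fun q => (q, f q)) hs hk v w
    rw [hg.fderiv, fderiv_fderiv_graph hf] at this
    rw [← map_smul]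
    simpa using! this

/-- The relations between the derivatives of `f` and those of `g` when the graph of `f` is mapped
to the graph of `g`. -/
theorem prolongation_relations {Φ : Trans} {f g : Base → ℝ} {p : Base}
    (hf : ContDiffAt ℝ ∞ f p) (hs : ContDiffAt ℝ ∞ Φ (p, f p))
    (hg : ContDiffAt ℝ ∞ g (Φ (p, f p)).1)
    (hfg : ∀ᶠ q in 𝓝 p, (Φ (q, f q)).2 = g (Φ (q, f q)).1) (v w : Base) :
    fderiv ℝ g (Φ (p, f p)).1 (fderiv ℝ Φ (p, f p) (v, fderiv ℝ f p v)).1 =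
      (fderiv ℝ Φ (p, f p) (v, fderiv ℝ f p v)).2 ∧
    fderiv ℝ (fderiv ℝ g) (Φ (p, f p)).1 (fderiv ℝ Φ (p, f p) (v, fderiv ℝ f p v)).1
        (fderiv ℝ Φ (p, f p) (w, fderiv ℝ f p w)).1 +
      fderiv ℝ g (Φ (p, f p)).1
        (fderiv ℝ (fderiv ℝ Φ) (p, f p) (v, fderiv ℝ f p v) (w, fderiv ℝ f p w) +
          fderiv ℝ (fderiv ℝ f) p v w • fderiv ℝ Φ (p, f p) (0, 1)).1 =
      (fderiv ℝ (fderiv ℝ Φ) (p, f p) (v, fderiv ℝ f p v) (w, fderiv ℝ f p w) +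
          fderiv ℝ (fderiv ℝ f) p v w • fderiv ℝ Φ (p, f p) (0, 1)).2 := by
  replace hf := hf.of_le two_le_infty
  replace hs := hs.of_le two_le_infty
  replace hg := hg.of_le two_le_infty
  have hK : ContDiffAt ℝ 2 (fun q => Φ (q, f q)) p :=
    hs.comp (f := fun q => (q, f q)) p (contDiffAt_id.prodMk hf)
  have hKd := (hK.differentiableAt (by norm_num)).hasFDerivAt
  have hK1 : ContDiffAt ℝ 2 (fun q => (Φ (q, f q)).1) p := hK.fst
  have d1 : fderiv ℝ (fun q => (Φ (q, f q)).1) p =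
      (ContinuousLinearMap.fst ℝ Base ℝ).comp (fderiv ℝ (fun q => Φ (q, f q)) p) := hKd.fst.fderiv
  have d2 : fderiv ℝ (fun q => (Φ (q, f q)).2) p =
      (ContinuousLinearMap.snd ℝ Base ℝ).comp (fderiv ℝ (fun q => Φ (q, f q)) p) := hKd.snd.fderiv
  have e : (fun q => (Φ (q, f q)).2) =ᶠ[𝓝 p] g ∘ (fun q => (Φ (q, f q)).1) := hfg
  have a1 := fun v => (fderiv_along_graph hf hs v v).1
  have a2 := (fderiv_along_graph hf hs v w).2
  constructor
  · have h1 := e.fderiv_eq (𝕜 := ℝ)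
    rw [fderiv_comp (f := fun q => (Φ (q, f q)).1) p (hg.differentiableAt (by norm_num))
      (hK1.differentiableAt (by norm_num)), d1, d2] at h1
    have h2 := DFunLike.congr_fun h1 v
    simp only [ContinuousLinearMap.comp_apply, a1] at h2
    exact h2.symm
  · have h1 := (e.fderiv (𝕜 := ℝ)).fderiv_eq (𝕜 := ℝ)
    have h2 := DFunLike.congr_fun (DFunLike.congr_fun h1 v) w
    rw [fderiv_fderiv_comp (h := fun q => (Φ (q, f q)).1) hg hK1, d1] at h2
    have s1 := fderiv_fderiv_clm_comp (ContinuousLinearMap.fst ℝ Base ℝ) hK v w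
    have s2 := fderiv_fderiv_clm_comp (ContinuousLinearMap.snd ℝ Base ℝ) hK v w
    simp only [ContinuousLinearMap.coe_fst', ContinuousLinearMap.coe_snd',
      ContinuousLinearMap.comp_apply, a1, a2] at h2 s1 s2
    rw [s1, s2] at h2
    exact h2.symm

/-- A graph transverse to the fibres of the image is mapped to a graph. -/
theorem exists_image_graph {Φ : Trans} {f : Base → ℝ} {p : Base}
    (hf : ContDiffAt ℝ ∞ f p) (hs : ContDiffAt ℝ ∞ Φ (p, f p))
    (hA : ∀ v, (fderiv ℝ Φ (p, f p) (v, fderiv ℝ f p v)).1 = 0 → v = 0) :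
    ∃ g : Base → ℝ, ContDiffAt ℝ ∞ g (Φ (p, f p)).1 ∧
      ∀ᶠ q in 𝓝 p, (Φ (q, f q)).2 = g (Φ (q, f q)).1 := by
  have hK : ContDiffAt ℝ ∞ (fun q => Φ (q, f q)) p :=
    hs.comp (f := fun q => (q, f q)) p (contDiffAt_id.prodMk hf)
  have hKd := (hK.differentiableAt (by simp)).hasFDerivAt
  have hh : ContDiffAt ℝ ∞ (fun q => (Φ (q, f q)).1) p := hK.fst
  set A := (ContinuousLinearMap.fst ℝ Base ℝ).comp (fderiv ℝ (fun q => Φ (q, f q)) p)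
  have d1 : HasFDerivAt (fun q => (Φ (q, f q)).1) A p := hKd.fst
  have inj : Function.Injective A.toLinearMap := by
    refine (injective_iff_map_eq_zero A.toLinearMap).2 fun v hv => hA v ?_
    rw [← (fderiv_along_graph (hf.of_le two_le_infty) (hs.of_le two_le_infty) v v).1]
    exact hv
  let e : Base ≃L[ℝ] Base := (LinearEquiv.ofInjectiveEndo A.toLinearMap inj).toContinuousLinearEquiv
  have he : (e : Base →L[ℝ] Base) = A := by
    ext <;> rfl
  rw [← he] at d1
  have hi := hh.to_localInverse d1 (by simp)
  -- The base map `q ↦ (Φ (q, f q)).1` is locally invertible; `g` is the `u`-component of the image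
  -- composed with its local inverse.
  refine ⟨fun P => (Φ (hh.localInverse d1 (by simp) P, f (hh.localInverse d1 (by simp) P))).2,
    ?_, ?_⟩
  · refine ContDiffAt.comp (g := fun q => (Φ (q, f q)).2) _ ?_ hi
    rw [hh.localInverse_apply_image]
    exact hK.snd
  · have := (hh.hasStrictFDerivAt' d1 (by simp)).eventually_left_inverse
    filter_upwards [this] with q hq
    have hq' : hh.localInverse d1 (by simp) (Φ (q, f q)).1 = q := hq
    simp only [hq']

end Prolongation

/-! ### Inverses and compositions of equation-preserving maps. -/

section Groupoid

theorem fderiv_apply_fderiv {f : Base → ℝ} {p : Base} (hf : ContDiffAt ℝ 2 f p) (v w : Base) :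
    fderiv ℝ (fun q => fderiv ℝ f q w) p v = fderiv ℝ (fderiv ℝ f) p v w := by
  rw [((differentiableAt_fderiv hf).hasFDerivAt.clm_apply (hasFDerivAt_const w p)).fderiv]
  simp

/-- The map of base points induced by a transformation and a transversal graph is open. -/
theorem eventually_of_eventually_image {Φ : Trans} {f : Base → ℝ} {p : Base}
    (hf : ContDiffAt ℝ ∞ f p) (hs : ContDiffAt ℝ ∞ Φ (p, f p))
    (hA : ∀ v, (fderiv ℝ Φ (p, f p) (v, fderiv ℝ f p v)).1 = 0 → v = 0) {R : Base → Prop}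
    (hR : ∀ᶠ q in 𝓝 p, R (Φ (q, f q)).1) : ∀ᶠ P in 𝓝 (Φ (p, f p)).1, R P := by
  have hK : ContDiffAt ℝ ∞ (fun q => Φ (q, f q)) p :=
    hs.comp (f := fun q => (q, f q)) p (contDiffAt_id.prodMk hf)
  have hh : ContDiffAt ℝ ∞ (fun q => (Φ (q, f q)).1) p := hK.fst
  have hKd := (hK.differentiableAt (by simp)).hasFDerivAt
  have d1 : HasFDerivAt (fun q => (Φ (q, f q)).1)
      ((ContinuousLinearMap.fst ℝ Base ℝ).comp (fderiv ℝ (fun q => Φ (q, f q)) p)) p := hKd.fst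
  set A := (ContinuousLinearMap.fst ℝ Base ℝ).comp (fderiv ℝ (fun q => Φ (q, f q)) p)
  have inj : Function.Injective A.toLinearMap := by
    refine (injective_iff_map_eq_zero A.toLinearMap).2 fun v hv => hA v ?_
    rw [← (fderiv_along_graph (hf.of_le two_le_infty) (hs.of_le two_le_infty) v v).1]
    exact hv
  have surj : A.range = ⊤ := LinearMap.range_eq_top.2 (LinearMap.injective_iff_surjective.1 inj)
  have := (hh.hasStrictFDerivAt' d1 (by simp)).map_nhds_eq_of_surj surj
  rw [← this]
  exact hR

/-- Transversality comes for free: a tangent vector of the graph of `f` with zero base image also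
has zero `u`-image, because the image lies in the graph of `g`, so it vanishes by injectivity of the
differential. The base map is then open, and a relation valid near `p` holds near the image point.
-/
theorem ProlongsTo.symm {Φ : Trans} (hΦ : IsPointTransformation Φ) {j k : Jet2}
    (h : ProlongsTo Φ j k) : ProlongsTo Φ.symm k j := by
  obtain ⟨f, g, p, hf, hp, hg, hfg, rfl, rfl⟩ := h
  have hs := hΦ.contDiffAt hp
  have hA : ∀ v, (fderiv ℝ Φ (p, f p) (v, fderiv ℝ f p v)).1 = 0 → v = 0 := by
    intro v hv
    have h2 := (prolongation_relations hf hs hg hfg v v).1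
    rw [hv, map_zero] at h2
    have h3 : fderiv ℝ Φ (p, f p) (v, fderiv ℝ f p v) = fderiv ℝ Φ (p, f p) 0 := by
      rw [map_zero]
      exact Prod.ext hv h2.symm
    exact congrArg Prod.fst (hΦ.fderiv_injective hp h3)
  have e0 : ((Φ (p, f p)).1, g (Φ (p, f p)).1) = Φ (p, f p) :=
    Prod.ext rfl hfg.self_of_nhds.symm
  have e1 : Φ.symm (Φ (p, f p)) = (p, f p) := Φ.left_inv hp
  refine ⟨g, f, (Φ (p, f p)).1, hg, ?_, ?_, ?_, rfl, ?_⟩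
  · rw [e0]
    exact Φ.map_source hp
  · rw [e0, e1]
    exact hf
  · refine eventually_of_eventually_image hf hs hA
      (R := fun P => (Φ.symm (P, g P)).2 = f (Φ.symm (P, g P)).1) ?_
    have hc : ContinuousAt (fun q => (q, f q)) p := continuousAt_id.prodMk hf.continuousAt
    filter_upwards [hfg, hc.eventually (Φ.open_source.mem_nhds hp)] with q hq hq'
    rw [← hq]
    change (Φ.symm (Φ (q, f q))).2 = f (Φ.symm (Φ (q, f q))).1
    rw [Φ.left_inv hq']
  · rw [e0, e1]

theorem MapsEquation.symm {Φ : Trans} (hΦ : IsPointTransformation Φ) {L M : Set Jet2}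
    (h : MapsEquation Φ L M) : MapsEquation Φ.symm M L := fun j k hjk =>
  (h k j (by simpa using hjk.symm hΦ.symm)).symm

/-- Equations are pushed forward by a composition if the first factor is projectable to the space
of independent variables. -/
theorem MapsEquation.trans {Φ Ψ : Trans} (hΦ : IsPointTransformation Φ)
    (hv : ∀ z ∈ Φ.source, (fderiv ℝ Φ z (0, 1)).1 = 0) {L M N : Set Jet2}
    (h : MapsEquation Φ L M) (h' : MapsEquation Ψ M N) : MapsEquation (Φ.trans Ψ) L N := by
  rintro j k ⟨f, g, p, hf, hp, hg, hfg, rfl, rfl⟩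
  have hp1 : (p, f p) ∈ Φ.source := hp.1
  have hs := hΦ.contDiffAt hp1
  have inj := hΦ.fderiv_injective hp1
  have hu := hv _ hp1
  -- A composition may prolong at a jet where its first factor does not. Projectability of `Φ`
  -- excludes this: the preimage of the vertical direction is vertical, hence never tangent to a
  -- graph, so an intermediate function `g₁` exists.
  have hA : ∀ v, (fderiv ℝ Φ (p, f p) (v, fderiv ℝ f p v)).1 = 0 → v = 0 := by
    intro v hv
    set D := fderiv ℝ Φ (p, f p)
    have hd : (D (0, 1)).2 ≠ 0 := by
      intro h0
      have : D (0, 1) = D 0 := by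
        rw [map_zero]
        exact Prod.ext hu h0
      simpa using congrArg Prod.snd (inj this)
    have h3 : D (v, fderiv ℝ f p v) = D (((D (v, fderiv ℝ f p v)).2 / (D (0, 1)).2) • (0, 1)) := by
      rw [map_smul]
      refine Prod.ext ?_ ?_
      · rw [hv, Prod.smul_fst, hu, smul_zero]
      · rw [Prod.smul_snd, smul_eq_mul, div_mul_cancel₀ _ hd]
    simpa using congrArg Prod.fst (inj h3)
  obtain ⟨g₁, hg₁, hfg₁⟩ := exists_image_graph hf hs hA
  have e0 : ((Φ (p, f p)).1, g₁ (Φ (p, f p)).1) = Φ (p, f p) :=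
    Prod.ext rfl hfg₁.self_of_nhds.symm
  refine (h _ _ ⟨f, g₁, p, hf, hp1, hg₁, hfg₁, rfl, rfl⟩).trans
    (h' _ _ ⟨g₁, g, (Φ (p, f p)).1, hg₁, ?_, ?_, ?_, rfl, ?_⟩)
  · rw [e0]
    exact hp.2
  · rw [e0]
    exact hg
  · refine eventually_of_eventually_image hf hs hA
      (R := fun P => (Ψ (P, g₁ P)).2 = g (Ψ (P, g₁ P)).1) ?_
    filter_upwards [hfg, hfg₁] with q hq hq'
    rw [← hq']
    exact hq
  · rw [e0]
    rfl

end Groupoid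

/-! ### The two explicit transformations: shifts and the inversion. -/

section Explicit

theorem contDiff_shift (c : ℝ) : ContDiff ℝ ∞ (shift c) := by
  change ContDiff ℝ ∞ fun z : Total => ((z.1.1, z.1.2.1 + c, z.1.2.2 + c * z.1.1), z.2)
  fun_prop

theorem shift_symm (c : ℝ) : (shift c).symm = shift (-c) := by
  refine OpenPartialHomeomorph.ext _ _ (fun z => ?_) (fun z => ?_) rfl
  · change ((z.1.1, z.1.2.1 - c, z.1.2.2 - c * z.1.1), z.2) =
      ((z.1.1, z.1.2.1 + -c, z.1.2.2 + -c * z.1.1), z.2)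
    simp [sub_eq_add_neg]
  · change ((z.1.1, z.1.2.1 + c, z.1.2.2 + c * z.1.1), z.2) =
      ((z.1.1, z.1.2.1 - -c, z.1.2.2 - -c * z.1.1), z.2)
    simp [sub_eq_add_neg]

theorem shift_trans_shift_neg (c : ℝ) :
    (shift c).trans (shift (-c)) = OpenPartialHomeomorph.refl Total := by
  refine OpenPartialHomeomorph.ext _ _ (fun z => ?_) (fun z => ?_) (by simp [shift])
  · rw [← shift_symm]
    exact (shift c).left_inv trivial
  · rw [← shift_symm]
    exact (shift c).left_inv trivial

theorem isPointTransformation_shift (c : ℝ) : IsPointTransformation (shift c) :=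
  ⟨⟨0, trivial⟩, (contDiff_shift c).contDiffOn,
    by rw [shift_symm]; exact (contDiff_shift (-c)).contDiffOn⟩

theorem hasFDerivAt_shift (c : ℝ) (z : Total) :
    HasFDerivAt (shift c) (ContinuousLinearMap.id ℝ Total +
      (ContinuousLinearMap.inl ℝ Base ℝ).comp ((ContinuousLinearMap.inr ℝ ℝ (ℝ × ℝ)).comp
        ((ContinuousLinearMap.inr ℝ ℝ ℝ).comp (c • (ContinuousLinearMap.fst ℝ ℝ (ℝ × ℝ)).comp
          (ContinuousLinearMap.fst ℝ Base ℝ))))) z := by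
  have : (shift c : Total → Total) = fun z => (ContinuousLinearMap.id ℝ Total +
      (ContinuousLinearMap.inl ℝ Base ℝ).comp ((ContinuousLinearMap.inr ℝ ℝ (ℝ × ℝ)).comp
        ((ContinuousLinearMap.inr ℝ ℝ ℝ).comp (c • (ContinuousLinearMap.fst ℝ ℝ (ℝ × ℝ)).comp
          (ContinuousLinearMap.fst ℝ Base ℝ))))) z + ((0, c, 0), 0) := by
    funext z
    change ((z.1.1, z.1.2.1 + c, z.1.2.2 + c * z.1.1), z.2) = _
    simp [Prod.ext_iff]
  rw [this]
  exact (ContinuousLinearMap.hasFDerivAt _).add_const _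

theorem fderiv_shift (c : ℝ) (z v : Total) :
    fderiv ℝ (shift c) z v = ((v.1.1, v.1.2.1, v.1.2.2 + c * v.1.1), v.2) := by
  rw [(hasFDerivAt_shift c z).fderiv]
  simp [Prod.ext_iff]

theorem fderiv_fderiv_shift (c : ℝ) (z : Total) : fderiv ℝ (fderiv ℝ (shift c)) z = 0 := by
  rw [show fderiv ℝ (shift c) = fun _ => _ from funext fun z => (hasFDerivAt_shift c z).fderiv]
  exact (hasFDerivAt_const _ _).fderiv

/-- The differential sends `∂_t` to `∂_t + c ∂_y`, so `f_t + x f_y = g_t + (x + c) g_y`; the map is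
affine, so `f_xx = g_xx`. -/
theorem mapsEquation_shift (c α β : ℝ) :
    MapsEquation (shift c) (eqF (α, β)) (eqF (α + c, β)) := by
  rintro j k ⟨f, g, p, hf, hp, hg, hfg, rfl, rfl⟩
  have hs := (isPointTransformation_shift c).contDiffAt hp
  have R := prolongation_relations hf hs hg hfg
  have h1 := (R (1, 0, 0) 0).1
  have h2 := (R (0, 0, 1) 0).1
  have h3 := (R (0, 1, 0) (0, 1, 0)).2
  have v1 : ∀ a, fderiv ℝ (shift c) (p, f p) ((1, 0, 0), a) =
      ((1, 0, 0) + c • (0, 0, 1), a) := fun a => by simp [fderiv_shift]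
  have v2 : ∀ a, fderiv ℝ (shift c) (p, f p) ((0, 0, 1), a) = ((0, 0, 1), a) :=
    fun a => by simp [fderiv_shift]
  have v3 : ∀ a, fderiv ℝ (shift c) (p, f p) ((0, 1, 0), a) = ((0, 1, 0), a) :=
    fun a => by simp [fderiv_shift]
  have v4 : fderiv ℝ (shift c) (p, f p) (0, 1) = (0, 1) := by simp [fderiv_shift]
  rw [v1, map_add, map_smul, smul_eq_mul] at h1
  rw [v2] at h2
  dsimp only at h1 h2
  rw [fderiv_fderiv_shift, v3, v4] at h3
  simp only [zero_apply, zero_add, Prod.smul_fst, Prod.smul_snd, smul_zero, map_zero, add_zero,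
    smul_eq_mul, mul_one] at h3
  rw [jet2_mem_eqF hf, jet2_mem_eqF hg]
  have ex : (shift c (p, f p)).1.2.1 = p.2.1 + c := rfl
  rw [← h1, ← h2, ← h3, ex]
  have e1 : p.2.1 + c ≠ α + c ↔ p.2.1 ≠ α := by simp
  have e2 : p.2.1 + c - (α + c) = p.2.1 - α := by ring
  simp only [e1, e2]
  refine and_congr_right fun _ => ⟨fun h => ?_, fun h => ?_⟩ <;> linear_combination h

/-- The transformation `(t, x, y, u) ↦ (y, 1 / x, t, u / x)` on the half-space `x > 0`. -/
noncomputable def inversion : Trans where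
  toFun := fun z => ((z.1.2.2, z.1.2.1⁻¹, z.1.1), z.2 * z.1.2.1⁻¹)
  invFun := fun z => ((z.1.2.2, z.1.2.1⁻¹, z.1.1), z.2 * z.1.2.1⁻¹)
  source := {z | 0 < z.1.2.1}
  target := {z | 0 < z.1.2.1}
  map_source' := fun z hz => inv_pos.2 (show 0 < z.1.2.1 from hz)
  map_target' := fun z hz => inv_pos.2 (show 0 < z.1.2.1 from hz)
  left_inv' := fun z hz => by
    have : z.1.2.1 ≠ 0 := ne_of_gt hz
    simp [this]
  right_inv' := fun z hz => by
    have : z.1.2.1 ≠ 0 := ne_of_gt hz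
    simp [this]
  open_source := isOpen_lt continuous_const (by fun_prop)
  open_target := isOpen_lt continuous_const (by fun_prop)
  continuousOn_toFun := fun z hz => by
    have : z.1.2.1 ≠ 0 := ne_of_gt hz
    exact ContinuousAt.continuousWithinAt (by fun_prop (disch := assumption))
  continuousOn_invFun := fun z hz => by
    have : z.1.2.1 ≠ 0 := ne_of_gt hz
    exact ContinuousAt.continuousWithinAt (by fun_prop (disch := assumption))

theorem mem_inversion_source (z : Total) : z ∈ inversion.source ↔ 0 < z.1.2.1 := Iff.rfl

theorem isPointTransformation_inversion : IsPointTransformation inversion := by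
  have : ContDiffOn ℝ ∞ (fun z : Total => (((z.1.2.2, z.1.2.1⁻¹, z.1.1), z.2 * z.1.2.1⁻¹) : Total))
      {z | 0 < z.1.2.1} := fun z hz => by
    have : z.1.2.1 ≠ 0 := ne_of_gt hz
    exact ContDiffAt.contDiffWithinAt (by fun_prop (disch := assumption))
  exact ⟨⟨((0, 1, 0), 0), (mem_inversion_source _).2 one_pos⟩, this, this⟩

theorem hasFDerivAt_inversion_base {q : Base} (hq : q.2.1 ≠ 0) :
    HasFDerivAt (fun q : Base => ((q.2.2, q.2.1⁻¹, q.1) : Base))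
      (((ContinuousLinearMap.snd ℝ ℝ ℝ).comp (ContinuousLinearMap.snd ℝ ℝ (ℝ × ℝ))).prod
        ((-(q.2.1 ^ 2)⁻¹ • (ContinuousLinearMap.fst ℝ ℝ ℝ).comp
          (ContinuousLinearMap.snd ℝ ℝ (ℝ × ℝ))).prod (ContinuousLinearMap.fst ℝ ℝ (ℝ × ℝ)))) q := by
  refine (hasFDerivAt_snd.snd).prodMk (HasFDerivAt.prodMk ?_ hasFDerivAt_fst)
  exact (hasDerivAt_inv hq).comp_hasFDerivAt q hasFDerivAt_snd.fst

/-- Here `w = x ^ β`, and `a, b, c, d` stand for `g_T, g_Y, g_X, g_XX`. The terms in `c` cancel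
thanks to the multiplier `1 / x` of `u`, and the two equations differ by the factor `x ^ 2`. -/
theorem inversion_condition {x : ℝ} (hx : 0 < x) (w a b c d : ℝ) :
    x * b + x * (x * a) =
        w * (-(x⁻¹ * (-(x ^ 2)⁻¹ * d)) + c * (x ^ 2)⁻¹ + -(x ^ 2)⁻¹ * c) ↔
      a + x⁻¹ * b = (x ^ 5 / w)⁻¹ * d := by
  have e : x * b + x * (x * a) -
      w * (-(x⁻¹ * (-(x ^ 2)⁻¹ * d)) + c * (x ^ 2)⁻¹ + -(x ^ 2)⁻¹ * c) =
      x ^ 2 * (a + x⁻¹ * b - (x ^ 5 / w)⁻¹ * d) := by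
    field_simp
    ring
  rw [← sub_eq_zero, e, mul_eq_zero, sub_eq_zero]
  simp [hx.ne']

theorem mapsEquation_inversion (β : ℝ) :
    MapsEquation inversion (eqF (0, β)) (eqF (0, 5 - β)) := by
  rintro j k ⟨f, g, p, hf, hp, hg, hfg, rfl, rfl⟩
  have hp0 : 0 < p.2.1 := hp
  have ev : ∀ᶠ q : Base in 𝓝 p, 0 < q.2.1 :=
    (isOpen_lt continuous_const (by fun_prop)).mem_nhds hp0
  let h : Base → Base := fun q => (q.2.2, q.2.1⁻¹, q.1)
  have hg2 : ContDiffAt ℝ 2 g (h p) := hg.of_le two_le_infty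
  have hc : ContinuousAt h p := (hasFDerivAt_inversion_base hp0.ne').continuousAt
  have hgd := hc.eventually (eventually_differentiableAt hg2)
  have e : f =ᶠ[𝓝 p] fun q => q.2.1 * g (h q) := by
    filter_upwards [ev, hfg] with q hq hq'
    have hq' : f q * q.2.1⁻¹ = g (h q) := hq'
    rw [← hq']
    field_simp
  have F : ∀ q : Base, 0 < q.2.1 → DifferentiableAt ℝ g (h q) → ∀ v,
      fderiv ℝ (fun q => q.2.1 * g (h q)) q v =
        q.2.1 * fderiv ℝ g (h q) (v.2.2, -(q.2.1 ^ 2)⁻¹ * v.2.1, v.1) + g (h q) * v.2.1 := by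
    intro q hq hgq v
    have h1 : HasFDerivAt (fun q => q.2.1 * g (h q)) _ q :=
      (hasFDerivAt_snd (𝕜 := ℝ) (p := q)).fst.mul
      (hgq.hasFDerivAt.comp q (hasFDerivAt_inversion_base hq.ne'))
    rw [h1.fderiv]
    simp [h]
  have e1 := fun v => DFunLike.congr_fun (e.fderiv_eq (𝕜 := ℝ)) v
  have et := e1 (1, 0, 0)
  have ey := e1 (0, 0, 1)
  rw [F p hp0 hgd.self_of_nhds] at et ey
  -- The first `x`-derivative is simplified in a whole neighbourhood, so that one more
  -- differentiation yields `f_xx`.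
  have e2 : (fun q => fderiv ℝ f q (0, 1, 0)) =ᶠ[𝓝 p] fun q =>
      -q.2.1⁻¹ * fderiv ℝ g (h q) (0, 1, 0) + g (h q) := by
    filter_upwards [ev, hgd, e.fderiv (𝕜 := ℝ)] with q hq hq' hq''
    rw [hq'', F q hq hq']
    have : ((0, -(q.2.1 ^ 2)⁻¹ * 1, 0) : Base) = (-(q.2.1 ^ 2)⁻¹) • (0, 1, 0) := by simp
    simp only [this, map_smul, smul_eq_mul]
    field_simp
  have exx := DFunLike.congr_fun (e2.fderiv_eq (𝕜 := ℝ)) (0, 1, 0)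
  rw [fderiv_apply_fderiv (hf.of_le two_le_infty)] at exx
  have hb := hasFDerivAt_inversion_base hp0.ne'
  have h1 := ((hasDerivAt_inv hp0.ne').neg.comp_hasFDerivAt p hasFDerivAt_snd.fst).mul
    (((differentiableAt_fderiv hg2).hasFDerivAt.comp p hb).clm_apply
      (hasFDerivAt_const ((0, 1, 0) : Base) p))
  have h2 : HasFDerivAt (fun q => -q.2.1⁻¹ * fderiv ℝ g (h q) (0, 1, 0) + g (h q)) _ p :=
    h1.add (hgd.self_of_nhds.hasFDerivAt.comp p hb)
  have h3 := DFunLike.congr_fun h2.fderiv (0, 1, 0)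
  replace exx := exx.trans h3
  have e5 : ((0, -(p.2.1 ^ 2)⁻¹, 0) : Base) = (-(p.2.1 ^ 2)⁻¹) • (0, 1, 0) := by simp
  simp [h] at et ey exx
  rw [e5, map_smul] at exx
  rw [jet2_mem_eqF hf, jet2_mem_eqF hg]
  have ex : (inversion (p, f p)).1 = (p.2.2, p.2.1⁻¹, p.1) := rfl
  rw [et, ey, exx, ex, map_smul]
  dsimp only
  rw [sub_zero, sub_zero, abs_of_pos hp0, abs_of_pos (inv_pos.2 hp0), Real.inv_rpow hp0.le,
    Real.rpow_sub hp0, Real.rpow_ofNat]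
  simp only [smul_apply, smul_eq_mul, ne_eq, hp0.ne', inv_eq_zero, not_false_eq_true, true_or,
    true_and]
  exact inversion_condition hp0 _ _ _ _ _

end Explicit

/-! ### Testing the equations on quadratic jets; projectability of `T` and `Y`. -/

section Determining

/-- The standard pairing on the space of independent variables. -/
def pair (ξ v : Base) : ℝ := ξ.1 * v.1 + ξ.2.1 * v.2.1 + ξ.2.2 * v.2.2

/-- The function with value `c`, gradient `ξ` and diagonal Hessian `B` at `p`. -/
noncomputable def quadratic (p : Base) (c : ℝ) (ξ B : Base) (q : Base) : ℝ :=
  c + pair ξ (q - p) +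
    (B.1 * (q.1 - p.1) ^ 2 + B.2.1 * (q.2.1 - p.2.1) ^ 2 + B.2.2 * (q.2.2 - p.2.2) ^ 2) / 2

theorem contDiff_quadratic (p : Base) (c : ℝ) (ξ B : Base) :
    ContDiff ℝ ∞ (quadratic p c ξ B) := by
  unfold quadratic pair
  fun_prop

theorem quadratic_self (p : Base) (c : ℝ) (ξ B : Base) : quadratic p c ξ B p = c := by
  simp [quadratic, pair]

theorem hasDerivAt_line {q v : Base} : HasDerivAt (fun s : ℝ => q + s • v) v 0 := by
  simpa using ((hasDerivAt_id (0 : ℝ)).smul_const v).const_add q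

theorem fderiv_quadratic (p : Base) (c : ℝ) (ξ B q v : Base) :
    fderiv ℝ (quadratic p c ξ B) q v = pair ξ v + (B.1 * (q.1 - p.1) * v.1 +
      B.2.1 * (q.2.1 - p.2.1) * v.2.1 + B.2.2 * (q.2.2 - p.2.2) * v.2.2) := by
  have h1 : HasFDerivAt (quadratic p c ξ B) (fderiv ℝ (quadratic p c ξ B) q) (q + (0 : ℝ) • v) := by
    simpa using ((contDiff_quadratic p c ξ B).differentiable (by simp) q).hasFDerivAt
  have h2 := h1.comp_hasDerivAt (0 : ℝ) hasDerivAt_line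
  refine h2.unique ?_
  have l : ∀ a b : ℝ, HasDerivAt (fun s : ℝ => a + s * b) b 0 := fun a b => by
    simpa using ((hasDerivAt_id (0 : ℝ)).mul_const b).const_add a
  have q1 := ((l q.1 v.1).sub_const p.1)
  have q2 := ((l q.2.1 v.2.1).sub_const p.2.1)
  have q3 := ((l q.2.2 v.2.2).sub_const p.2.2)
  have := (((((q1.const_mul ξ.1).add (q2.const_mul ξ.2.1)).add (q3.const_mul ξ.2.2)).const_add
    c).add (((((q1.pow 2).const_mul B.1).add ((q2.pow 2).const_mul B.2.1)).add
      ((q3.pow 2).const_mul B.2.2)).div_const 2))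
  refine this.congr_deriv ?_
  simp [pair]
  ring

theorem fderiv_fderiv_quadratic (p : Base) (c : ℝ) (ξ B v w : Base) :
    fderiv ℝ (fderiv ℝ (quadratic p c ξ B)) p v w =
      B.1 * v.1 * w.1 + B.2.1 * v.2.1 * w.2.1 + B.2.2 * v.2.2 * w.2.2 := by
  rw [← fderiv_apply_fderiv ((contDiff_quadratic p c ξ B).contDiffAt.of_le two_le_infty),
    show (fun q => fderiv ℝ (quadratic p c ξ B) q w) = quadratic p (pair ξ w)
      (B.1 * w.1, B.2.1 * w.2.1, B.2.2 * w.2.2) 0 from ?_, fderiv_quadratic]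
  · simp [pair]
    ring
  · funext q
    rw [fderiv_quadratic]
    simp [quadratic, pair]
    ring

/-- Linear maps out of the space of all variables are determined by their values on the basis. -/
theorem map_total {F : Type*} [NormedAddCommGroup F] [NormedSpace ℝ F] (D : Total →L[ℝ] F)
    (a b c s : ℝ) : D ((a, b, c), s) = a • D ((1, 0, 0), 0) + b • D ((0, 1, 0), 0) +
      c • D ((0, 0, 1), 0) + s • D (0, 1) := by
  simp only [← map_smul, ← map_add]
  simp

theorem pair_smul (ξ : Base) (c : ℝ) (v : Base) : pair ξ (c • v) = c * pair ξ v := by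
  simp [pair]
  ring

theorem pair_add (ξ v w : Base) : pair ξ (v + w) = pair ξ v + pair ξ w := by
  simp [pair]
  ring

theorem graph_add (ξ v w : Base) :
    ((v + w, pair ξ (v + w)) : Total) = (v, pair ξ v) + (w, pair ξ w) :=
  Prod.ext rfl (pair_add ξ v w)

theorem graph_smul (ξ : Base) (c : ℝ) (v : Base) :
    ((c • v, pair ξ (c • v)) : Total) = c • (v, pair ξ v) :=
  Prod.ext rfl (pair_smul ξ c v)

/-- The map induced on tangent vectors of the base by a graph with gradient `ξ`. -/
def inducedMap (D : Total →L[ℝ] Total) (ξ : Base) : Base →ₗ[ℝ] Base where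
  toFun v := (D (v, pair ξ v)).1
  map_add' v w := by
    rw [graph_add, map_add, Prod.fst_add]
  map_smul' c v := by
    rw [graph_smul, map_smul, Prod.smul_fst, RingHom.id_apply]

/-- The gradient of the image of a transversal graph. -/
theorem exists_image_gradient {D : Total →L[ℝ] Total} {ξ : Base}
    (hA : Function.Injective (inducedMap D ξ)) :
    ∃ γ : Base →L[ℝ] ℝ, ∀ v, γ (D (v, pair ξ v)).1 = (D (v, pair ξ v)).2 := by
  let e := LinearEquiv.ofInjectiveEndo (inducedMap D ξ) hA
  let γ : Base →ₗ[ℝ] ℝ :=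
    { toFun := fun P => (D (e.symm P, pair ξ (e.symm P))).2
      map_add' := fun v w => by
        rw [map_add, graph_add, map_add, Prod.snd_add]
      map_smul' := fun c v => by
        rw [map_smul, graph_smul, map_smul, Prod.smul_snd, RingHom.id_apply] }
  refine ⟨γ.toContinuousLinearMap, fun v => ?_⟩
  have : e.symm (D (v, pair ξ v)).1 = v := e.symm_apply_apply v
  change (D (e.symm (D (v, pair ξ v)).1, pair ξ (e.symm (D (v, pair ξ v)).1))).2 = _
  rw [this]

/-- This number is the factor with which second derivatives of `f` enter those of `g`. Were it zero,
`D (0, 1)` would lie in the image of the tangent space of the graph, making the vertical vector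
tangent to the graph. -/
theorem image_slope_ne_zero {D : Total →L[ℝ] Total} (hD : Function.Injective D) {ξ : Base}
    (hA : Function.Injective (inducedMap D ξ)) {γ : Base →L[ℝ] ℝ}
    (hγ : ∀ v, γ (D (v, pair ξ v)).1 = (D (v, pair ξ v)).2) :
    (D (0, 1)).2 - γ (D (0, 1)).1 ≠ 0 := by
  intro h0
  obtain ⟨b, hb⟩ := LinearMap.injective_iff_surjective.1 hA (D (0, 1)).1
  have hb : (D (b, pair ξ b)).1 = (D (0, 1)).1 := hb
  have h1 := hγ b
  rw [hb] at h1
  have h2 : (b, pair ξ b) = ((0, 1) : Total) := hD (Prod.ext hb (by linarith))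
  have h3 : b = 0 := congrArg Prod.fst h2
  have h4 : pair ξ b = 1 := congrArg Prod.snd h2
  rw [h3] at h4
  simp [pair] at h4

/-- The condition for an equation to be mapped to another one, at the jets with given gradient `ξ`
and diagonal Hessian `B`. -/
theorem MapsEquation.condition {Φ : Trans} (hΦ : IsPointTransformation Φ) {θ θ' : ℝ × ℝ}
    (h : MapsEquation Φ (eqF θ) (eqF θ')) {z : Total} (hz : z ∈ Φ.source) (hx : z.1.2.1 ≠ θ.1)
    (hX : (Φ z).1.2.1 ≠ θ'.1) {ξ a : Base} (hA : Function.Injective (inducedMap (fderiv ℝ Φ z) ξ))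
    (ha : (fderiv ℝ Φ z (a, pair ξ a)).1 = (0, 1, 0)) {γ : Base →L[ℝ] ℝ}
    (hγ : ∀ v, γ (fderiv ℝ Φ z (v, pair ξ v)).1 = (fderiv ℝ Φ z (v, pair ξ v)).2) (B : Base) :
    ξ.1 + z.1.2.1 * ξ.2.2 = |z.1.2.1 - θ.1| ^ θ.2 * B.2.1 ↔
      γ (1, 0, 0) + (Φ z).1.2.1 * γ (0, 0, 1) = |(Φ z).1.2.1 - θ'.1| ^ θ'.2 *
        ((fderiv ℝ (fderiv ℝ Φ) z (a, pair ξ a) (a, pair ξ a)).2 -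
          γ (fderiv ℝ (fderiv ℝ Φ) z (a, pair ξ a) (a, pair ξ a)).1 +
          (B.1 * a.1 ^ 2 + B.2.1 * a.2.1 ^ 2 + B.2.2 * a.2.2 ^ 2) *
            ((fderiv ℝ Φ z (0, 1)).2 - γ (fderiv ℝ Φ z (0, 1)).1)) := by
  obtain ⟨p, c⟩ := z
  set f := quadratic p c ξ B
  have fp : f p = c := quadratic_self p c ξ B
  have hf : ContDiffAt ℝ ∞ f p := (contDiff_quadratic p c ξ B).contDiffAt
  have f1 : ∀ v, fderiv ℝ f p v = pair ξ v := fun v => by simp [f, fderiv_quadratic]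
  have hp : (p, f p) ∈ Φ.source := by rwa [fp]
  have hs := hΦ.contDiffAt hp
  obtain ⟨g, hg, hfg⟩ := exists_image_graph hf hs (fun v hv => by
    rw [fp, f1] at hv
    exact (injective_iff_map_eq_zero _).1 hA v hv)
  have key := h _ _ ⟨f, g, p, hf, hp, hg, hfg, rfl, rfl⟩
  have R := prolongation_relations hf hs hg hfg
  simp only [fp, f1] at R
  rw [jet2_mem_eqF hf, jet2_mem_eqF hg] at key
  -- By transversality every base vector is the image of a tangent vector, so the first-order
  -- relation determines the gradient of `g`.
  have hgγ : fderiv ℝ g (Φ (p, c)).1 = γ := by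
    refine ContinuousLinearMap.ext fun P => ?_
    obtain ⟨v, rfl⟩ := LinearMap.injective_iff_surjective.1 hA P
    exact (R v 0).1.trans (hγ v).symm
  have R2 := (R a a).2
  rw [ha, hgγ] at R2
  rw [fp, hgγ] at key
  simp only [hx, hX, ne_eq, not_false_eq_true, true_or, true_and, f1] at key
  have e1 : pair ξ (1, 0, 0) = ξ.1 := by simp [pair]
  have e2 : pair ξ (0, 0, 1) = ξ.2.2 := by simp [pair]
  have e3 : fderiv ℝ (fderiv ℝ f) p (0, 1, 0) (0, 1, 0) = B.2.1 := by
    simp [f, fderiv_fderiv_quadratic]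
  have e4 : fderiv ℝ (fderiv ℝ f) p a a =
      B.1 * a.1 ^ 2 + B.2.1 * a.2.1 ^ 2 + B.2.2 * a.2.2 ^ 2 := by
    simp only [f, fderiv_fderiv_quadratic]
    ring
  rw [e1, e2, e3] at key
  rw [e4] at R2
  simp only [Prod.fst_add, Prod.snd_add, Prod.smul_fst, Prod.smul_snd, map_add, map_smul,
    smul_eq_mul] at R2
  rw [key, show fderiv ℝ (fderiv ℝ g) (Φ (p, c)).1 (0, 1, 0) (0, 1, 0) = _ from
    eq_sub_of_add_eq R2]
  refine Eq.congr rfl (congrArg _ ?_)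
  ring

/-- Transversality means that `k`, the preimage of the vertical vector, is not tangent to the graph
with gradient `ξ`. -/
theorem inducedMap_injective {D : Total →L[ℝ] Total} (hD : Function.Injective D) {k : Total}
    (hk : D k = (0, 1)) {ξ : Base} (hξ : pair ξ k.1 ≠ k.2) :
    Function.Injective (inducedMap D ξ) := by
  refine (injective_iff_map_eq_zero _).2 fun v hv => ?_
  have hv : (D (v, pair ξ v)).1 = 0 := hv
  have h1 : (v, pair ξ v) = (D (v, pair ξ v)).2 • k := by
    refine hD ?_
    rw [map_smul, hk]
    refine Prod.ext ?_ ?_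
    · simpa using hv
    · simp
  set s := (D (v, pair ξ v)).2
  have h2 : v = s • k.1 := congrArg Prod.fst h1
  have h3 : pair ξ v = s * k.2 := congrArg Prod.snd h1
  have h4 : s * (pair ξ k.1 - k.2) = 0 := by
    rw [h2, pair_smul] at h3
    linear_combination h3
  rcases mul_eq_zero.1 h4 with h5 | h5
  · rw [h2, h5, zero_smul]
  · exact absurd (sub_eq_zero.1 h5) hξ

theorem exists_pair_ne {k : Total} (hk : k ≠ 0) : ∃ ξ : Base, pair ξ k.1 ≠ k.2 := by
  by_cases h : k.2 = 0
  · refine ⟨k.1, fun h1 => hk ?_⟩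
    rw [h] at h1
    simp only [pair] at h1
    have a1 : k.1.1 = 0 := by nlinarith [sq_nonneg k.1.1, sq_nonneg k.1.2.1, sq_nonneg k.1.2.2]
    have a2 : k.1.2.1 = 0 := by nlinarith [sq_nonneg k.1.1, sq_nonneg k.1.2.1, sq_nonneg k.1.2.2]
    have a3 : k.1.2.2 = 0 := by nlinarith [sq_nonneg k.1.1, sq_nonneg k.1.2.1, sq_nonneg k.1.2.2]
    exact Prod.ext (Prod.ext a1 (Prod.ext a2 a3)) h
  · exact ⟨0, by simpa [pair] using Ne.symm h⟩

section Generic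

variable {Φ : Trans} {θ θ' : ℝ × ℝ} {z : Total}

/-- The vector `a` is the preimage of `∂_X` under the induced map. The image equation contains
`f_aa` with a nonzero factor, while the source equation ignores `f_tt` and `f_yy`; hence `a` is a
multiple of `∂_x`. -/
theorem MapsEquation.along_x (hΦ : IsPointTransformation Φ)
    (h : MapsEquation Φ (eqF θ) (eqF θ')) (hz : z ∈ Φ.source) (hx : z.1.2.1 ≠ θ.1)
    (hX : (Φ z).1.2.1 ≠ θ'.1) {ξ : Base} (hA : Function.Injective (inducedMap (fderiv ℝ Φ z) ξ)) :
    (fderiv ℝ Φ z ((0, 1, 0), ξ.2.1)).1.1 = 0 ∧ (fderiv ℝ Φ z ((0, 1, 0), ξ.2.1)).1.2.2 = 0 := by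
  obtain ⟨γ, hγ⟩ := exists_image_gradient hA
  obtain ⟨a, ha⟩ := LinearMap.injective_iff_surjective.1 hA (0, 1, 0)
  have ha : (fderiv ℝ Φ z (a, pair ξ a)).1 = (0, 1, 0) := ha
  have hκ := image_slope_ne_zero (hΦ.fderiv_injective hz) hA hγ
  have hm : 0 < |z.1.2.1 - θ.1| ^ θ.2 := Real.rpow_pos_of_pos (abs_pos.2 (sub_ne_zero.2 hx)) _
  have hM : 0 < |(Φ z).1.2.1 - θ'.1| ^ θ'.2 :=
    Real.rpow_pos_of_pos (abs_pos.2 (sub_ne_zero.2 hX)) _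
  have key := h.condition hΦ hz hx hX hA ha hγ
  set κ := (fderiv ℝ Φ z (0, 1)).2 - γ (fderiv ℝ Φ z (0, 1)).1
  set m := |z.1.2.1 - θ.1| ^ θ.2
  -- The source equation fixes the middle entry of the Hessian; the outer two are switched on in
  -- turn.
  have hc : ξ.1 + z.1.2.1 * ξ.2.2 = m * ((ξ.1 + z.1.2.1 * ξ.2.2) / m) := by field_simp
  have k0 := (key (0, (ξ.1 + z.1.2.1 * ξ.2.2) / m, 0)).1 hc
  have k1 := (key (1, (ξ.1 + z.1.2.1 * ξ.2.2) / m, 0)).1 hc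
  have k3 := (key (0, (ξ.1 + z.1.2.1 * ξ.2.2) / m, 1)).1 hc
  rw [k0] at k1 k3
  have a1 : a.1 = 0 := by
    have := mul_left_cancel₀ hM.ne' k1
    have : a.1 ^ 2 * κ = 0 := by linear_combination -this
    simpa [hκ] using this
  have a3 : a.2.2 = 0 := by
    have := mul_left_cancel₀ hM.ne' k3
    have : a.2.2 ^ 2 * κ = 0 := by linear_combination -this
    simpa [hκ] using this
  have e : (a, pair ξ a) = a.2.1 • (((0, 1, 0), ξ.2.1) : Total) := by
    simp [Prod.ext_iff, pair, a1, a3, mul_comm]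
  rw [e, map_smul] at ha
  simp only [Prod.ext_iff, Prod.smul_fst, Prod.smul_snd, smul_eq_mul] at ha
  obtain ⟨h1, h2, h3⟩ := ha
  have h0 : a.2.1 ≠ 0 := fun h0 => by simp [h0] at h2
  exact ⟨(mul_eq_zero.1 h1).resolve_left h0, (mul_eq_zero.1 h3).resolve_left h0⟩

/-- The images of `t` and `y` do not depend on `x` and `u`. -/
theorem MapsEquation.ty_projectable (hΦ : IsPointTransformation Φ)
    (h : MapsEquation Φ (eqF θ) (eqF θ')) (hz : z ∈ Φ.source) (hx : z.1.2.1 ≠ θ.1)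
    (hX : (Φ z).1.2.1 ≠ θ'.1) :
    ((fderiv ℝ Φ z ((0, 1, 0), 0)).1.1 = 0 ∧ (fderiv ℝ Φ z ((0, 1, 0), 0)).1.2.2 = 0) ∧
      (fderiv ℝ Φ z (0, 1)).1.1 = 0 ∧ (fderiv ℝ Φ z (0, 1)).1.2.2 = 0 := by
  have inj := hΦ.fderiv_injective hz
  obtain ⟨k, hk⟩ := hΦ.fderiv_surjective hz (0, 1)
  have hk0 : k ≠ 0 := by
    rintro rfl
    rw [map_zero] at hk
    exact zero_ne_one (congrArg Prod.snd hk)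
  obtain ⟨ξ, hξ⟩ := exists_pair_ne hk0
  have h0 := h.along_x hΦ hz hx hX (inducedMap_injective inj hk hξ)
  -- A second transversal gradient with another `x`-slope separates the `x`- and `u`-derivatives.
  -- The defect `pair ξ k.1 - k.2` is affine in `s` and nonzero at `0`, so it cannot vanish at both
  -- `1` and `-1`.
  have h1 : ∃ s : ℝ, s ≠ 0 ∧ pair (ξ + s • (0, 1, 0)) k.1 ≠ k.2 := by
    have e : ∀ s : ℝ, pair (ξ + s • (0, 1, 0)) k.1 = pair ξ k.1 + s * k.1.2.1 := fun s => by
      simp [pair]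
      ring
    by_contra! H
    have H1 := H 1 one_ne_zero
    have H2 := H (-1) (by norm_num)
    rw [e] at H1 H2
    exact hξ (by linarith)
  obtain ⟨s, hs, hs'⟩ := h1
  have h2 := h.along_x hΦ hz hx hX (inducedMap_injective inj hk hs')
  have e1 := map_total (fderiv ℝ Φ z) 0 1 0 ξ.2.1
  have e2 := map_total (fderiv ℝ Φ z) 0 1 0 (ξ + s • ((0, 1, 0) : Base)).2.1
  rw [e1] at h0
  rw [e2] at h2
  simp at h0 h2
  have t : (fderiv ℝ Φ z (0, 1)).1.1 = 0 :=
    (mul_eq_zero.1 (by linear_combination h2.1 - h0.1)).resolve_left hs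
  have y : (fderiv ℝ Φ z (0, 1)).1.2.2 = 0 :=
    (mul_eq_zero.1 (by linear_combination h2.2 - h0.2)).resolve_left hs
  rw [t, y] at h0
  exact ⟨by simpa using h0, t, y⟩

end Generic

end Determining

/-! ### The determining equations. -/

section Equivalence

variable {Φ : Trans} {θ θ' : ℝ × ℝ} {z : Total}

/-- The second derivatives of a projectable component of the transformation vanish in the
corresponding directions. -/
theorem fderiv_fderiv_eq_zero (hΦ : ContDiffAt ℝ ∞ Φ z) (A : Total →L[ℝ] ℝ) (w : Total)
    (h : ∀ᶠ z' in 𝓝 z, A (fderiv ℝ Φ z' w) = 0) (v : Total) :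
    A (fderiv ℝ (fderiv ℝ Φ) z v w) = 0 := by
  have h1 := (differentiableAt_fderiv (hΦ.of_le two_le_infty)).hasFDerivAt.clm_apply
    (hasFDerivAt_const w z)
  have h2 := (A.hasFDerivAt.comp z h1).fderiv
  have h3 : (A ∘ fun z' => fderiv ℝ Φ z' w) =ᶠ[𝓝 z] fun _ => 0 := h
  rw [h3.fderiv_eq, fderiv_fun_const] at h2
  simpa using (DFunLike.congr_fun h2 v).symm

/-- Here `q` is the slope `u_x`, and `d` is the preimage of `∂_T + X ∂_Y`. With `q` fixed, the image
equation is affine in `r = u_t` and `s = u_y`, and comparing coefficients gives the two relations.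
The hypothesis `hQ` leaves second derivatives of `Φ` only in `X` and `U`, so their contribution does
not depend on `r, s`. -/
theorem MapsEquation.slope_condition (hΦ : IsPointTransformation Φ)
    (h : MapsEquation Φ (eqF θ) (eqF θ')) (hz : z ∈ Φ.source) (hx : z.1.2.1 ≠ θ.1)
    (hX : (Φ z).1.2.1 ≠ θ'.1)
    (hQ : ∀ v : Total, ∀ b s : ℝ, (fderiv ℝ (fderiv ℝ Φ) z v ((0, b, 0), s)).1.1 = 0 ∧
      (fderiv ℝ (fderiv ℝ Φ) z v ((0, b, 0), s)).1.2.2 = 0)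
    {d : Total} (hd : fderiv ℝ Φ z d = ((1, 0, (Φ z).1.2.1), 0)) {q : ℝ}
    (hq : (fderiv ℝ Φ z ((0, 1, 0), q)).1.2.1 ≠ 0) :
    |z.1.2.1 - θ.1| ^ θ.2 * (fderiv ℝ Φ z ((0, 1, 0), q)).1.2.1 ^ 2 * d.1.1 =
        |(Φ z).1.2.1 - θ'.1| ^ θ'.2 ∧
      |z.1.2.1 - θ.1| ^ θ.2 * (fderiv ℝ Φ z ((0, 1, 0), q)).1.2.1 ^ 2 * d.1.2.2 =
        z.1.2.1 * |(Φ z).1.2.1 - θ'.1| ^ θ'.2 := by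
  obtain ⟨⟨tx, yx⟩, tu, yu⟩ := h.ty_projectable hΦ hz hx hX
  have inj := hΦ.fderiv_injective hz
  have hm : 0 < |z.1.2.1 - θ.1| ^ θ.2 := Real.rpow_pos_of_pos (abs_pos.2 (sub_ne_zero.2 hx)) _
  obtain ⟨k, hk⟩ := hΦ.fderiv_surjective hz (0, 1)
  set X := (Φ z).1.2.1
  set D := fderiv ℝ Φ z
  set μ := (D ((0, 1, 0), q)).1.2.1
  set m := |z.1.2.1 - θ.1| ^ θ.2
  have tq : (D ((0, 1, 0), q)).1.1 = 0 := by
    rw [map_total]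
    simp [tx, tu]
  have yq : (D ((0, 1, 0), q)).1.2.2 = 0 := by
    rw [map_total]
    simp [yx, yu]
  have Dq : (D ((0, 1, 0), q)).1 = (0, μ, 0) := Prod.ext tq (Prod.ext rfl yq)
  have Du : (D (0, 1)).1 = (0, (D (0, 1)).1.2.1, 0) := Prod.ext tu (Prod.ext rfl yu)
  -- transversality
  have hA : ∀ r s : ℝ, Function.Injective (inducedMap D (r, q, s)) := by
    intro r s
    refine (injective_iff_map_eq_zero _).2 fun v hv => ?_
    have hv : (D (v, pair (r, q, s) v)).1 = 0 := hv
    obtain ⟨e₁, he₁⟩ := hΦ.fderiv_surjective hz ((1, 0, 0), 0)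
    obtain ⟨e₂, he₂⟩ := hΦ.fderiv_surjective hz ((0, 0, 1), 0)
    have he₁ : D e₁ = ((1, 0, 0), 0) := he₁
    have he₂ : D e₂ = ((0, 0, 1), 0) := he₂
    have c := fun w : Total => map_total D w.1.1 w.1.2.1 w.1.2.2 w.2
    rw [show e₁ = ((e₁.1.1, e₁.1.2.1, e₁.1.2.2), e₁.2) from rfl, c e₁] at he₁
    rw [show e₂ = ((e₂.1.1, e₂.1.2.1, e₂.1.2.2), e₂.2) from rfl, c e₂] at he₂
    have hv' := c (v, pair (r, q, s) v)
    have hv1 := congrArg (fun w : Total => w.1.1) hv'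
    have hv2 := congrArg (fun w : Total => w.1.2.2) hv'
    have hv0 : (D (v, pair (r, q, s) v)).1.1 = 0 := congrArg Prod.fst hv
    have hv00 : (D (v, pair (r, q, s) v)).1.2.2 = 0 := congrArg (fun w : Base => w.2.2) hv
    simp only [Prod.ext_iff, Prod.fst_add, Prod.snd_add, Prod.smul_fst, Prod.smul_snd,
      smul_eq_mul, tx, yx, tu, yu, mul_zero, add_zero, hv0, hv00, Prod.mk.eta] at he₁ he₂ hv1 hv2
    obtain ⟨⟨p1, -, p2⟩, -⟩ := he₁
    obtain ⟨⟨p3, -, p4⟩, -⟩ := he₂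
    set Tt := (D ((1, 0, 0), 0)).1.1
    set Ty := (D ((0, 0, 1), 0)).1.1
    set Yt := (D ((1, 0, 0), 0)).1.2.2
    set Yy := (D ((0, 0, 1), 0)).1.2.2
    -- The preimages of `∂_T` and `∂_Y` invert the Jacobian matrix of `(T, Y)` in `(t, y)`; this is
    -- the product of determinants.
    have J : (Tt * Yy - Ty * Yt) * (e₁.1.1 * e₂.1.2.2 - e₁.1.2.2 * e₂.1.1) = 1 := by
      have : (e₁.1.1 * Tt + e₁.1.2.2 * Ty) * (e₂.1.1 * Yt + e₂.1.2.2 * Yy) -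
        (e₁.1.1 * Yt + e₁.1.2.2 * Yy) * (e₂.1.1 * Tt + e₂.1.2.2 * Ty) = 1 := by
        rw [p1, p2, p3, p4]
        norm_num
      linear_combination this
    have J0 : Tt * Yy - Ty * Yt ≠ 0 := left_ne_zero_of_mul_eq_one J
    have v1 : v.1 = 0 := (mul_eq_zero.1 (show (Tt * Yy - Ty * Yt) * v.1 = 0 by
      linear_combination -Yy * hv1 + Ty * hv2)).resolve_left J0
    have v3 : v.2.2 = 0 := (mul_eq_zero.1 (show (Tt * Yy - Ty * Yt) * v.2.2 = 0 by
      linear_combination Yt * hv1 - Tt * hv2)).resolve_left J0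
    have e : (v, pair (r, q, s) v) = v.2.1 • (((0, 1, 0), q) : Total) := by
      simp [Prod.ext_iff, pair, v1, v3, mul_comm]
    rw [e, map_smul, Prod.smul_fst, Dq] at hv
    have v2 : v.2.1 * μ = 0 := congrArg (fun w : Base => w.2.1) hv
    exact Prod.ext v1 (Prod.ext ((mul_eq_zero.1 v2).resolve_right hq) v3)
  -- the condition for all values of the other two derivatives
  have key : ∃ κ ρ : ℝ, κ ≠ 0 ∧ ∀ r s : ℝ, κ * (pair (r, q, s) d.1 - d.2) =
      |X - θ'.1| ^ θ'.2 * (ρ + κ * ((r + z.1.2.1 * s) / (m * μ ^ 2))) := by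
    set Q := fderiv ℝ (fderiv ℝ Φ) z ((0, μ⁻¹, 0), μ⁻¹ * q) ((0, μ⁻¹, 0), μ⁻¹ * q)
    have Q1 : Q.1 = (0, Q.1.2.1, 0) := Prod.ext (hQ _ _ _).1 (Prod.ext rfl (hQ _ _ _).2)
    have hγ' : ∀ r s : ℝ, ∀ γ : Base →L[ℝ] ℝ, (∀ v, γ (D (v, pair (r, q, s) v)).1 =
        (D (v, pair (r, q, s) v)).2) → ∀ b : ℝ, γ (0, b, 0) = b * ((D ((0, 1, 0), q)).2 / μ) := by
      intro r s γ hγ b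
      have h1 := hγ (0, 1, 0)
      have e : pair (r, q, s) (0, 1, 0) = q := by simp [pair]
      rw [e, Dq] at h1
      have e2 : ((0, b, 0) : Base) = (b / μ) • (0, μ, 0) := by
        simp [div_mul_cancel₀ _ hq]
      rw [e2, map_smul, h1, smul_eq_mul]
      ring
    refine ⟨(D (0, 1)).2 - (D (0, 1)).1.2.1 * ((D ((0, 1, 0), q)).2 / μ),
      Q.2 - Q.1.2.1 * ((D ((0, 1, 0), q)).2 / μ), ?_, fun r s => ?_⟩
    · obtain ⟨γ, hγ⟩ := exists_image_gradient (hA 0 0)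
      have h1 := image_slope_ne_zero inj (hA 0 0) hγ
      rwa [Du, hγ' 0 0 γ hγ] at h1
    · obtain ⟨γ, hγ⟩ := exists_image_gradient (hA r s)
      have ea : (((0, μ⁻¹, 0), pair (r, q, s) (0, μ⁻¹, 0)) : Total) = ((0, μ⁻¹, 0), μ⁻¹ * q) := by
        simp [pair, mul_comm]
      have ha : (D ((0, μ⁻¹, 0), pair (r, q, s) (0, μ⁻¹, 0))).1 = (0, 1, 0) := by
        rw [ea, show (((0, μ⁻¹, 0), μ⁻¹ * q) : Total) = μ⁻¹ • ((0, 1, 0), q) by simp, map_smul,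
          Prod.smul_fst, Dq]
        simp [inv_mul_cancel₀ hq]
      have h1 := (h.condition hΦ hz hx hX (hA r s) ha hγ (0, (r + z.1.2.1 * s) / m, 0)).1 (by
        change _ = m * _
        field_simp)
      rw [ea] at h1
      change γ (1, 0, 0) + X * γ (0, 0, 1) = _ * (Q.2 - γ Q.1 + _ * ((D (0, 1)).2 - γ (D (0, 1)).1))
        at h1
      rw [Q1, Du, hγ' r s γ hγ, hγ' r s γ hγ] at h1
      have h2 := hγ d.1
      have e3 : (d.1, pair (r, q, s) d.1) = d + (pair (r, q, s) d.1 - d.2) • ((0, 1) : Total) := by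
        simp [Prod.ext_iff]
      have e4 : ((1, 0, X) : Base) = (1, 0, 0) + X • (0, 0, 1) := by simp
      rw [e3, map_add, map_smul, hd] at h2
      simp only [Prod.fst_add, Prod.snd_add, Prod.smul_fst, Prod.smul_snd, map_add, map_smul,
        smul_eq_mul, e4] at h2
      rw [Du, hγ' r s γ hγ] at h2
      have e5 : (r + z.1.2.1 * s) / (m * μ ^ 2) = (r + z.1.2.1 * s) / m * μ⁻¹ ^ 2 := by
        field_simp
      rw [e5]
      dsimp only at h1 ⊢
      linear_combination h1 - h2
  obtain ⟨κ, ρ, hκ, H⟩ := key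
  have H0 := H 0 0
  have H1 := H 1 0
  have H3 := H 0 1
  simp only [pair, zero_mul, mul_zero, zero_add, add_zero, one_mul, mul_one, zero_div] at H0 H1 H3
  have G1 : κ * d.1.1 = κ * (|X - θ'.1| ^ θ'.2 * (1 / (m * μ ^ 2))) := by
    linear_combination H1 - H0
  have G3 : κ * d.1.2.2 = κ * (|X - θ'.1| ^ θ'.2 * (z.1.2.1 / (m * μ ^ 2))) := by
    linear_combination H3 - H0
  rw [mul_left_cancel₀ hκ G1, mul_left_cancel₀ hκ G3]
  constructor <;> field_simp

/-- The determining equations at a point where the equations have no singularity. -/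
theorem MapsEquation.determining (hΦ : IsPointTransformation Φ)
    (h : MapsEquation Φ (eqF θ) (eqF θ')) (hz : z ∈ Φ.source) (hx : z.1.2.1 ≠ θ.1)
    (hX : (Φ z).1.2.1 ≠ θ'.1) :
    (fderiv ℝ Φ z (0, 1)).1 = 0 ∧ (fderiv ℝ Φ z ((0, 1, 0), 0)).1.1 = 0 ∧
    (fderiv ℝ Φ z ((0, 1, 0), 0)).1.2.2 = 0 ∧
    (fderiv ℝ Φ z ((1, 0, z.1.2.1), 0)).1.1 ≠ 0 ∧
    (fderiv ℝ Φ z ((1, 0, z.1.2.1), 0)).1.2.2 =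
      (Φ z).1.2.1 * (fderiv ℝ Φ z ((1, 0, z.1.2.1), 0)).1.1 ∧
    |z.1.2.1 - θ.1| ^ θ.2 * (fderiv ℝ Φ z ((0, 1, 0), 0)).1.2.1 ^ 2 =
      |(Φ z).1.2.1 - θ'.1| ^ θ'.2 * (fderiv ℝ Φ z ((1, 0, z.1.2.1), 0)).1.1 := by
  have hs := hΦ.contDiffAt hz
  obtain ⟨⟨tx, yx⟩, tu, yu⟩ := h.ty_projectable hΦ hz hx hX
  have ev : ∀ᶠ w in 𝓝 z, w ∈ Φ.source ∧ w.1.2.1 ≠ θ.1 ∧ (Φ w).1.2.1 ≠ θ'.1 :=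
    Filter.Eventually.and (Φ.open_source.mem_nhds hz)
      (((continuous_fst.comp (continuous_snd.comp continuous_fst)).continuousAt.eventually_ne
        hx).and (hs.continuousAt.fst.snd.fst.eventually_ne hX))
  have hQ : ∀ v : Total, ∀ b s : ℝ, (fderiv ℝ (fderiv ℝ Φ) z v ((0, b, 0), s)).1.1 = 0 ∧
      (fderiv ℝ (fderiv ℝ Φ) z v ((0, b, 0), s)).1.2.2 = 0 := by
    intro v b s
    constructor
    · refine fderiv_fderiv_eq_zero hs ((ContinuousLinearMap.fst ℝ ℝ (ℝ × ℝ)).comp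
        (ContinuousLinearMap.fst ℝ Base ℝ)) _ (ev.mono fun w hw => ?_) v
      obtain ⟨⟨h1, -⟩, h2, -⟩ := h.ty_projectable hΦ hw.1 hw.2.1 hw.2.2
      change (fderiv ℝ Φ w ((0, b, 0), s)).1.1 = 0
      rw [map_total]
      simp [h1, h2]
    · refine fderiv_fderiv_eq_zero hs ((ContinuousLinearMap.snd ℝ ℝ ℝ).comp
        ((ContinuousLinearMap.snd ℝ ℝ (ℝ × ℝ)).comp
        (ContinuousLinearMap.fst ℝ Base ℝ))) _ (ev.mono fun w hw => ?_) v
      obtain ⟨⟨-, h1⟩, -, h2⟩ := h.ty_projectable hΦ hw.1 hw.2.1 hw.2.2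
      change (fderiv ℝ Φ w ((0, b, 0), s)).1.2.2 = 0
      rw [map_total]
      simp [h1, h2]
  obtain ⟨d, hd⟩ := hΦ.fderiv_surjective hz ((1, 0, (Φ z).1.2.1), 0)
  have S := fun q => h.slope_condition hΦ hz hx hX hQ hd (q := q)
  have hm : 0 < |z.1.2.1 - θ.1| ^ θ.2 := Real.rpow_pos_of_pos (abs_pos.2 (sub_ne_zero.2 hx)) _
  have hM : 0 < |(Φ z).1.2.1 - θ'.1| ^ θ'.2 :=
    Real.rpow_pos_of_pos (abs_pos.2 (sub_ne_zero.2 hX)) _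
  have inj := hΦ.fderiv_injective hz
  set X := (Φ z).1.2.1
  set D := fderiv ℝ Φ z
  set m := |z.1.2.1 - θ.1| ^ θ.2
  set M := |X - θ'.1| ^ θ'.2
  have eq1 : ∀ q : ℝ, (D ((0, 1, 0), q)).1.2.1 =
      (D ((0, 1, 0), 0)).1.2.1 + q * (D (0, 1)).1.2.1 := fun q => by
    rw [map_total D 0 1 0 q]
    simp
  -- If `X_u ≠ 0`, suitable slopes make `X_x + q X_u` equal to `1` and to `2`, whereas its square
  -- times a fixed quantity must equal the same positive number.
  have xu : (D (0, 1)).1.2.1 = 0 := by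
    by_contra hne
    have e : ∀ c : ℝ, (D ((0, 1, 0), (c - (D ((0, 1, 0), 0)).1.2.1) / (D (0, 1)).1.2.1)).1.2.1 = c :=
      fun c => by
        rw [eq1, div_mul_cancel₀ _ hne]
        ring
    have S1 := (S _ (by rw [e 1]; exact one_ne_zero)).1
    have S2 := (S _ (by rw [e 2]; exact two_ne_zero)).1
    rw [e] at S1 S2
    linarith
  have hu : (D (0, 1)).1 = 0 := Prod.ext tu (Prod.ext xu yu)
  have hX0 : (D ((0, 1, 0), 0)).1.2.1 ≠ 0 := by
    intro h0
    have hu2 : (D (0, 1)).2 ≠ 0 := by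
      intro h2
      have := @inj (0, 1) 0 (by rw [map_zero]; exact Prod.ext hu h2)
      exact one_ne_zero (congrArg Prod.snd this)
    have : D ((0, 1, 0), 0) = D (((D ((0, 1, 0), 0)).2 / (D (0, 1)).2) • (0, 1)) := by
      rw [map_smul]
      refine Prod.ext ?_ ?_
      · rw [Prod.smul_fst, hu, smul_zero]
        exact Prod.ext tx (Prod.ext h0 yx)
      · rw [Prod.smul_snd, smul_eq_mul, div_mul_cancel₀ _ hu2]
    have := congrArg (fun w : Total => w.1.2.1) (inj this)
    simp at this
  obtain ⟨S1, S3⟩ := S 0 hX0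
  set μ := (D ((0, 1, 0), 0)).1.2.1
  have hd3 : d.1.2.2 = z.1.2.1 * d.1.1 := by
    refine mul_left_cancel₀ (mul_ne_zero hm.ne' (pow_ne_zero 2 hX0)) ?_
    linear_combination S3 - z.1.2.1 * S1
  -- Modulo `∂_x` and `∂_u`, which do not affect `T` and `Y`, the vector `d` is `d.1.1` times `∂_t +
  -- x ∂_y`.
  have ed := map_total D d.1.1 d.1.2.1 d.1.2.2 d.2
  have ez := map_total D 1 0 z.1.2.1 0
  have ed' : D d = ((1, 0, X), 0) := hd
  rw [show ((d.1.1, d.1.2.1, d.1.2.2), d.2) = d from rfl, ed', hd3] at ed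
  have ed1 := congrArg (fun w : Total => w.1.1) ed
  have ed2 := congrArg (fun w : Total => w.1.2.2) ed
  have ez1 := congrArg (fun w : Total => w.1.1) ez
  have ez2 := congrArg (fun w : Total => w.1.2.2) ez
  simp [tx, yx, tu, yu] at ed1 ed2 ez1 ez2
  set Dt := (D ((1, 0, z.1.2.1), 0)).1.1
  set Dy := (D ((1, 0, z.1.2.1), 0)).1.2.2
  have P1 : d.1.1 * Dt = 1 := by
    rw [ez1]
    linear_combination -ed1
  have P2 : d.1.1 * Dy = X := by
    rw [ez2]
    linear_combination -ed2
  refine ⟨hu, tx, yx, right_ne_zero_of_mul_eq_one P1, ?_, ?_⟩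
  · linear_combination Dt * P2 - Dy * P1
  · linear_combination Dt * S1 - m * μ ^ 2 * P1

end Equivalence

/-! ### Restriction on the exponents. -/

section Necessity

theorem exists_mem_x_ne {O : Set Total} (hO : IsOpen O) (hne : O.Nonempty) (c : ℝ) :
    ∃ z ∈ O, z.1.2.1 ≠ c := by
  obtain ⟨z, hz⟩ := hne
  by_cases h : z.1.2.1 = c
  · have hc : ContinuousAt (fun s : ℝ => (((z.1.1, z.1.2.1 + s, z.1.2.2), z.2) : Total)) 0 := by
      fun_prop
    have h1 : ∀ᶠ s in 𝓝 (0 : ℝ), (((z.1.1, z.1.2.1 + s, z.1.2.2), z.2) : Total) ∈ O :=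
      hc.eventually (hO.mem_nhds (by simpa using hz))
    obtain ⟨s, hs, hs0⟩ :=
      ((h1.filter_mono nhdsWithin_le_nhds).and (self_mem_nhdsWithin (s := {0}ᶜ))).exists
    refine ⟨_, hs, ?_⟩
    simpa [h] using hs0
  · exact ⟨z, hz, h⟩

/-- Nonsingular points are dense, so the determining equations reach every nonempty open part of the
domain. -/
theorem exists_generic {Φ : Trans} {O : Set Total} (hO : IsOpen O) (hne : O.Nonempty)
    (hsub : O ⊆ Φ.source) (c c' : ℝ) : ∃ z ∈ O, z.1.2.1 ≠ c ∧ (Φ z).1.2.1 ≠ c' := by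
  have h1 : IsOpen (O ∩ {z | z.1.2.1 ≠ c}) :=
    hO.inter (isOpen_ne_fun (by fun_prop) continuous_const)
  obtain ⟨z, hz, hzc⟩ := exists_mem_x_ne hO hne c
  have h2 := Φ.isOpen_image_of_subset_source h1 (inter_subset_left.trans hsub)
  obtain ⟨_, ⟨w, ⟨hw, hwc⟩, rfl⟩, hw'⟩ := exists_mem_x_ne h2 ⟨_, z, ⟨hz, hzc⟩, rfl⟩ c'
  exact ⟨w, hw, hwc, hw'⟩

/-- Admissible transformations are projectable to the space of independent variables. -/
theorem MapsEquation.projectable {Φ : Trans} (hΦ : IsPointTransformation Φ) {θ θ' : ℝ × ℝ}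
    (h : MapsEquation Φ (eqF θ) (eqF θ')) : ∀ z ∈ Φ.source, (fderiv ℝ Φ z (0, 1)).1 = 0 := by
  by_contra! H
  obtain ⟨z, hz, hz0⟩ := H
  have hc : ContinuousOn (fun z => (fderiv ℝ Φ z (0, 1)).1) Φ.source :=
    ((hΦ.2.1.continuousOn_fderiv_of_isOpen Φ.open_source (by simp)).clm_apply
      continuousOn_const).fst
  -- Failure of projectability is an open condition, so it would occur at a nonsingular point.
  have hO : IsOpen (Φ.source ∩ {z | (fderiv ℝ Φ z (0, 1)).1 ≠ 0}) :=
    hc.isOpen_inter_preimage Φ.open_source isOpen_ne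
  obtain ⟨w, ⟨hw, hw0⟩, hx, hX⟩ :=
    exists_generic hO ⟨z, hz, hz0⟩ inter_subset_left θ.1 θ'.1
  exact hw0 (h.determining hΦ hw hx hX).1

/-- The classification of the solutions of the determining equations. -/
theorem exponents_of_ode {β β' p q r w x₀ ε : ℝ} {X X' : ℝ → ℝ} (hε : 0 < ε)
    (h : ∀ s ∈ Metric.ball x₀ ε, s ≠ 0 ∧ X s ≠ 0 ∧ HasDerivAt X (X' s) s ∧ p + s * q ≠ 0 ∧
      r + s * w = X s * (p + s * q) ∧ |s| ^ β * X' s ^ 2 = |X s| ^ β' * (p + s * q)) :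
    β' = β ∨ β + β' = 5 := by
  have l : ∀ a b s : ℝ, HasDerivAt (fun s : ℝ => a + s * b) b s := fun a b s => by
    simpa using ((hasDerivAt_id s).mul_const b).const_add a
  have nh : ∀ s ∈ Metric.ball x₀ ε, Metric.ball x₀ ε ∈ 𝓝 s := fun s hs =>
    Metric.isOpen_ball.mem_nhds hs
  -- The derivative of the fractional linear function `(r + s w) / (p + s q)`.
  have hJ : ∀ s ∈ Metric.ball x₀ ε, X' s * (p + s * q) ^ 2 = w * p - r * q := by
    intro s hs
    obtain ⟨-, -, h3, -, h5, -⟩ := h s hs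
    have e : (fun s => r + s * w) =ᶠ[𝓝 s] fun s => X s * (p + s * q) :=
      Filter.mem_of_superset (nh s hs) fun t ht => (h t ht).2.2.2.2.1
    have := ((l r w s).congr_of_eventuallyEq e.symm).unique (h3.mul (l p q s))
    linear_combination -(p + s * q) * this + q * h5
  -- `Real.log` is insensitive to sign, so no sign analysis is needed. The `5` is `1 + 4`: one
  -- factor `p + s q` on the right, four from the square of `X'`.
  have hlog : ∀ s ∈ Metric.ball x₀ ε, w * p - r * q ≠ 0 ∧ r + s * w ≠ 0 ∧
      β * Real.log s + 2 * Real.log (w * p - r * q) =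
        β' * Real.log (r + s * w) + (5 - β') * Real.log (p + s * q) := by
    intro s hs
    obtain ⟨h1, h2, -, h4, h5, h6⟩ := h s hs
    have a1 : |s| ^ β ≠ 0 := (Real.rpow_pos_of_pos (abs_pos.2 h1) _).ne'
    have a2 : |X s| ^ β' ≠ 0 := (Real.rpow_pos_of_pos (abs_pos.2 h2) _).ne'
    have a3 : X' s ≠ 0 := by
      intro h0
      rw [h0] at h6
      simp [a2, h4] at h6
    refine ⟨?_, ?_, ?_⟩
    · rw [← hJ s hs]
      positivity
    · rw [h5]
      exact mul_ne_zero h2 h4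
    · have e := congrArg Real.log h6
      rw [Real.log_mul a1 (pow_ne_zero 2 a3), Real.log_mul a2 h4,
        Real.log_rpow (abs_pos.2 h1), Real.log_rpow (abs_pos.2 h2), Real.log_abs, Real.log_abs,
        Real.log_pow] at e
      rw [← hJ s hs, h5, Real.log_mul a3 (pow_ne_zero 2 h4), Real.log_mul h2 h4, Real.log_pow]
      push_cast at e ⊢
      linear_combination e
  have hpoly : ∀ s ∈ Metric.ball x₀ ε, β * ((r + s * w) * (p + s * q)) =
      β' * (w * (s * (p + s * q))) + (5 - β') * (q * (s * (r + s * w))) := by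
    intro s hs
    obtain ⟨h1, -, -, h4, -, -⟩ := h s hs
    obtain ⟨-, hN, -⟩ := hlog s hs
    have e : (fun s => β * Real.log s + 2 * Real.log (w * p - r * q)) =ᶠ[𝓝 s]
        fun s => β' * Real.log (r + s * w) + (5 - β') * Real.log (p + s * q) :=
      Filter.mem_of_superset (nh s hs) fun t ht => (hlog t ht).2.2
    have d1 := ((Real.hasDerivAt_log h1).const_mul β).add_const (2 * Real.log (w * p - r * q))
    have d2 := (((l r w s).log hN).const_mul β').add (((l p q s).log h4).const_mul (5 - β'))
    have := (d1.congr_of_eventuallyEq e.symm).unique d2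
    field_simp at this
    linear_combination this
  have m0 : x₀ ∈ Metric.ball x₀ ε := Metric.mem_ball_self hε
  have m1 : x₀ + ε / 2 ∈ Metric.ball x₀ ε := by
    rw [Metric.mem_ball, Real.dist_eq, add_sub_cancel_left, abs_of_pos (by linarith)]
    linarith
  have m2 : x₀ - ε / 2 ∈ Metric.ball x₀ ε := by
    rw [Metric.mem_ball, Real.dist_eq, sub_sub_cancel_left, abs_neg, abs_of_pos (by linarith)]
    linarith
  have f0 := hpoly _ m0
  have f1 := hpoly _ m1
  have f2 := hpoly _ m2
  have J0 := (hlog _ m0).1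
  -- The three coefficients of the quadratic identity come from its values at `x₀` and `x₀ ± ε / 2`.
  have c2 : (β - 5) * (w * q) = 0 :=
    (mul_eq_zero.1 (show ε ^ 2 * ((β - 5) * (w * q)) = 0 by
      linear_combination 2 * f1 + 2 * f2 - 4 * f0)).resolve_left (by positivity)
  have c1 : β * (r * q + w * p) - β' * (w * p) - (5 - β') * (q * r) = 0 :=
    (mul_eq_zero.1 (show ε * (β * (r * q + w * p) - β' * (w * p) - (5 - β') * (q * r)) = 0 by
      linear_combination f1 - f2 - 2 * ε * x₀ * c2)).resolve_left hε.ne'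
  have c0 : β * (r * p) = 0 := by linear_combination f0 - x₀ * c1 - x₀ ^ 2 * c2
  by_cases hw : w = 0
  · subst hw
    have hrq : r * q ≠ 0 := fun h0 => J0 (by linear_combination -h0)
    right
    have := (mul_eq_zero.1 (show r * q * (β + β' - 5) = 0 by linear_combination c1)).resolve_left hrq
    linarith
  by_cases hq : q = 0
  · subst hq
    have hwp : w * p ≠ 0 := fun h0 => J0 (by linear_combination h0)
    left
    have := (mul_eq_zero.1 (show w * p * (β' - β) = 0 by linear_combination -c1)).resolve_left hwp
    linarith
  have hβ : β = 5 := by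
    have := (mul_eq_zero.1 c2).resolve_right (mul_ne_zero hw hq)
    linarith
  subst hβ
  rcases mul_eq_zero.1 ((mul_eq_zero.1 c0).resolve_left (by norm_num)) with h0 | h0
  · subst h0
    have hwp : w * p ≠ 0 := fun h0 => J0 (by linear_combination h0)
    left
    have := (mul_eq_zero.1 (show w * p * (β' - 5) = 0 by linear_combination -c1)).resolve_left hwp
    linarith
  · subst h0
    have hrq : r * q ≠ 0 := fun h0 => J0 (by linear_combination -h0)
    right
    have := (mul_eq_zero.1 (show r * q * β' = 0 by linear_combination c1)).resolve_left hrq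
    linarith

theorem hasDerivAt_x_total (z : Total) (s : ℝ) :
    HasDerivAt (fun s => (((z.1.1, s, z.1.2.2), z.2) : Total)) ((0, 1, 0), 0) s :=
  ((hasDerivAt_const _ _).prodMk ((hasDerivAt_id _).prodMk (hasDerivAt_const _ _))).prodMk
    (hasDerivAt_const _ _)

/-- The derivatives of a component that does not depend on `x` do not depend on `x`. -/
theorem fderiv_const_along_x {Φ : Trans} (hΦ : IsPointTransformation Φ) (z : Total) {ε : ℝ}
    (hε : 0 < ε) (A : Total →L[ℝ] ℝ)
    (h : ∀ s ∈ Metric.ball z.1.2.1 ε, (((z.1.1, s, z.1.2.2), z.2) : Total) ∈ Φ.source ∧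
      ∀ᶠ z' in 𝓝 (((z.1.1, s, z.1.2.2), z.2) : Total), A (fderiv ℝ Φ z' ((0, 1, 0), 0)) = 0)
    (v : Total) : ∀ s ∈ Metric.ball z.1.2.1 ε,
      A (fderiv ℝ Φ ((z.1.1, s, z.1.2.2), z.2) v) = A (fderiv ℝ Φ z v) := by
  have hd : ∀ s ∈ Metric.ball z.1.2.1 ε,
      HasDerivAt (fun s => A (fderiv ℝ Φ ((z.1.1, s, z.1.2.2), z.2) v)) 0 s := by
    intro s hs
    have hs' := (hΦ.contDiffAt (h s hs).1)
    have h1 := (differentiableAt_fderiv (hs'.of_le two_le_infty)).hasFDerivAt.clm_apply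
      (hasFDerivAt_const v _)
    have h2 := (A.hasFDerivAt.comp _ h1).comp_hasDerivAt s (hasDerivAt_x_total z s)
    refine h2.congr_deriv ?_
    -- By symmetry the `x`-derivative of the `v`-derivative is the `v`-derivative of the
    -- `x`-derivative, which vanishes identically nearby.
    have sym := (hs'.isSymmSndFDerivAt (by simpa using two_le_infty)) v ((0, 1, 0), 0)
    have := fderiv_fderiv_eq_zero hs' A ((0, 1, 0), 0) (h s hs).2 v
    rw [sym] at this
    simpa using this
  intro s hs
  exact Metric.isOpen_ball.is_const_of_deriv_eq_zero (convex_ball _ _).isPreconnected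
    (fun t ht => (hd t ht).differentiableAt.differentiableWithinAt)
    (fun t ht => (hd t ht).deriv) hs (Metric.mem_ball_self hε)

/-- Along a segment in the `x`-direction, `p, q, r, w` are the constants `T_t, T_y, Y_t, Y_y`, and
the determining equations become the hypotheses of `exponents_of_ode`. -/
theorem MapsEquation.exponents {Φ : Trans} (hΦ : IsPointTransformation Φ) {β β' : ℝ}
    (h : MapsEquation Φ (eqF (0, β)) (eqF (0, β'))) : β' = β ∨ β + β' = 5 := by
  obtain ⟨z, hz, hx, hX⟩ := exists_generic Φ.open_source hΦ.1 subset_rfl 0 0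
  have ev : ∀ w : Total, (w ∈ Φ.source ∧ w.1.2.1 ≠ 0 ∧ (Φ w).1.2.1 ≠ 0) →
      ∀ᶠ w in 𝓝 w, w ∈ Φ.source ∧ w.1.2.1 ≠ 0 ∧ (Φ w).1.2.1 ≠ 0 := fun w hw =>
    Filter.Eventually.and (Φ.open_source.mem_nhds hw.1)
      (((continuous_fst.comp (continuous_snd.comp continuous_fst)).continuousAt.eventually_ne
        hw.2.1).and ((hΦ.contDiffAt hw.1).continuousAt.fst.snd.fst.eventually_ne hw.2.2))
  have hev := (hasDerivAt_x_total z z.1.2.1).continuousAt.eventually (ev z ⟨hz, hx, hX⟩)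
  obtain ⟨ε, hε, hball⟩ := Metric.eventually_nhds_iff_ball.1 hev
  have det := fun (w : Total) (hw : w ∈ Φ.source ∧ w.1.2.1 ≠ 0 ∧ (Φ w).1.2.1 ≠ 0) =>
    h.determining hΦ (z := w) hw.1 hw.2.1 hw.2.2
  have T := fderiv_const_along_x hΦ z hε ((ContinuousLinearMap.fst ℝ ℝ (ℝ × ℝ)).comp
    (ContinuousLinearMap.fst ℝ Base ℝ)) (fun s hs => ⟨(hball s hs).1,
      (ev _ (hball s hs)).mono fun w hw => (det w hw).2.1⟩)
  have Y := fderiv_const_along_x hΦ z hε ((ContinuousLinearMap.snd ℝ ℝ ℝ).comp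
    ((ContinuousLinearMap.snd ℝ ℝ (ℝ × ℝ)).comp (ContinuousLinearMap.fst ℝ Base ℝ)))
      (fun s hs => ⟨(hball s hs).1, (ev _ (hball s hs)).mono fun w hw => (det w hw).2.2.1⟩)
  simp only [ContinuousLinearMap.comp_apply, ContinuousLinearMap.coe_fst',
    ContinuousLinearMap.coe_snd'] at T Y
  refine exponents_of_ode (x₀ := z.1.2.1) (p := (fderiv ℝ Φ z ((1, 0, 0), 0)).1.1)
    (q := (fderiv ℝ Φ z ((0, 0, 1), 0)).1.1) (r := (fderiv ℝ Φ z ((1, 0, 0), 0)).1.2.2)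
    (w := (fderiv ℝ Φ z ((0, 0, 1), 0)).1.2.2)
    (X := fun s => (Φ ((z.1.1, s, z.1.2.2), z.2)).1.2.1)
    (X' := fun s => (fderiv ℝ Φ ((z.1.1, s, z.1.2.2), z.2) ((0, 1, 0), 0)).1.2.1) hε
    fun s hs => ?_
  obtain ⟨-, -, -, d1, d2, d3⟩ := det _ (hball s hs)
  obtain ⟨b1, b2, b3⟩ := hball s hs
  dsimp only at d1 d2 d3
  rw [map_total _ 1 0 s 0] at d1 d2 d3
  simp only [Prod.fst_add, Prod.snd_add, Prod.smul_fst, Prod.smul_snd, smul_eq_mul, one_mul,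
    zero_mul, add_zero, T _ s hs, Y _ s hs, sub_zero] at d1 d2 d3
  refine ⟨b2, b3, ?_, d1, d2, d3⟩
  exact ((hΦ.contDiffAt b1).differentiableAt (by simp)).hasFDerivAt.fst.snd.fst.comp_hasDerivAt s
    (hasDerivAt_x_total z s)

end Necessity

/-! ### Conjugation by shifts and generation of the groupoid. -/

section Groupoids

theorem eqF'_eq (β : ℝ) : eqF' β = eqF (0, β) := by
  simp [eqF', eqF]

theorem equivalenceGroupoid_symm {ι : Type} {E : ι → Set Jet2} {a b : ι} {Φ : Trans}
    (h : (a, Φ, b) ∈ equivalenceGroupoid E) : (b, Φ.symm, a) ∈ equivalenceGroupoid E :=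
  ⟨h.1.symm, MapsEquation.symm h.1 h.2⟩

theorem equivalenceGroupoid_trans {a b c : ℝ × ℝ} {Φ Ψ : Trans}
    (h : (a, Φ, b) ∈ equivalenceGroupoid eqF) (h' : (b, Ψ, c) ∈ equivalenceGroupoid eqF)
    (hne : (Φ.trans Ψ).source.Nonempty) : (a, Φ.trans Ψ, c) ∈ equivalenceGroupoid eqF :=
  ⟨IsPointTransformation.trans h.1 h'.1 hne,
    MapsEquation.trans h.1 (MapsEquation.projectable h.1 h.2) h.2 h'.2⟩

theorem shift_mem (c α β : ℝ) : ((α, β), shift c, (α + c, β)) ∈ equivalenceGroupoid eqF :=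
  ⟨isPointTransformation_shift c, mapsEquation_shift c α β⟩

theorem nonempty_trans_shift {Φ : Trans} (h : Φ.source.Nonempty) (c : ℝ) :
    (Φ.trans (shift c)).source.Nonempty := by
  obtain ⟨z, hz⟩ := h
  exact ⟨z, hz, trivial⟩

theorem nonempty_shift_trans {Φ : Trans} (h : Φ.source.Nonempty) (c : ℝ) :
    ((shift c).trans Φ).source.Nonempty := by
  obtain ⟨z, hz⟩ := h
  refine ⟨(shift c).symm z, trivial, ?_⟩
  change shift c ((shift c).symm z) ∈ Φ.source
  rwa [(shift c).right_inv trivial]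

theorem conj_mem {α β α' β' : ℝ} {Φ : Trans} (c c' : ℝ)
    (h : ((α, β), Φ, (α', β')) ∈ equivalenceGroupoid eqF) :
    ((α + c, β), (shift (-c)).trans (Φ.trans (shift c')), (α' + c', β')) ∈
      equivalenceGroupoid eqF := by
  have h1 := shift_mem (-c) (α + c) β
  rw [add_neg_cancel_right] at h1
  have h2 := nonempty_trans_shift h.1.1 c'
  exact equivalenceGroupoid_trans h1 (equivalenceGroupoid_trans h (shift_mem c' α' β') h2)
    (nonempty_shift_trans h2 _)

theorem shift_neg_trans_shift (c : ℝ) :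
    (shift (-c)).trans (shift c) = OpenPartialHomeomorph.refl Total := by
  simpa using shift_trans_shift_neg (-c)

/-- Every admissible transformation is conjugate, by shifts, to one of the gauged class. -/
theorem exists_gauged {α β α' β' : ℝ} {Φ : Trans}
    (h : ((α, β), Φ, (α', β')) ∈ equivalenceGroupoid eqF) :
    ∃ Ψ : Trans, (β, Ψ, β') ∈ equivalenceGroupoid eqF' ∧
      Φ = (shift (-α)).trans (Ψ.trans (shift α')) := by
  -- `trans` composes from left to right: shift from `0` to `α`, apply `Φ`, shift from `α'` back to
  -- `0`.
  refine ⟨(shift α).trans (Φ.trans (shift (-α'))), ?_, ?_⟩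
  · have := conj_mem (-α) (-α') h
    rw [add_neg_cancel, add_neg_cancel, neg_neg] at this
    change IsPointTransformation _ ∧ MapsEquation _ (eqF' β) (eqF' β')
    rw [eqF'_eq, eqF'_eq]
    exact this
  · rw [OpenPartialHomeomorph.trans_assoc, OpenPartialHomeomorph.trans_assoc,
      shift_neg_trans_shift, OpenPartialHomeomorph.trans_refl,
      ← OpenPartialHomeomorph.trans_assoc, shift_neg_trans_shift,
      OpenPartialHomeomorph.refl_trans]

theorem embed_mem {A : ℝ × Trans × ℝ} (h : A ∈ equivalenceGroupoid eqF') :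
    embed A ∈ equivalenceGroupoid eqF := by
  obtain ⟨h1, h2⟩ := h
  rw [eqF'_eq, eqF'_eq] at h2
  exact ⟨h1, h2⟩

theorem generated_eq : {A | Generated (shiftArrows ∪ embed '' equivalenceGroupoid eqF') A} =
    equivalenceGroupoid eqF := by
  ext A
  constructor
  · intro h
    induction h with
    | of h =>
      rcases h with ⟨α, β, rfl⟩ | ⟨B, hB, rfl⟩
      · simpa using shift_mem (-α) α β
      · exact embed_mem hB
    | inv _ ih => exact equivalenceGroupoid_symm ih
    | comp _ _ hne ih ih' => exact equivalenceGroupoid_trans ih ih' hne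
  · obtain ⟨⟨α, β⟩, Φ, ⟨α', β'⟩⟩ := A
    intro h
    obtain ⟨Ψ, hΨ, rfl⟩ := exists_gauged h
    have h2 := nonempty_trans_shift hΨ.1.1 α'
    refine .comp (.of (.inl ⟨α, β, rfl⟩)) (.comp (.of (.inr ⟨_, hΨ, rfl⟩)) ?_ h2)
      (nonempty_shift_trans h2 _)
    -- The last factor `shift α'` is the inverse of a generating arrow.
    have := Generated.inv (.of (.inl ⟨α', β', rfl⟩) :
      Generated (shiftArrows ∪ embed '' equivalenceGroupoid eqF') ((α', β'), shift (-α'), (0, β')))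
    rwa [shift_symm, neg_neg] at this

theorem similar_gauged_of_add_eq {β β' : ℝ} (h : β + β' = 5) :
    (((0 : ℝ), β), inversion, ((0 : ℝ), β')) ∈ equivalenceGroupoid eqF := by
  obtain rfl : β' = 5 - β := by linarith
  exact ⟨isPointTransformation_inversion, mapsEquation_inversion β⟩

end Groupoids

end Kolmogorov


/-! ### Assembly of the theorem. -/

theorem mainTheorem5 :
    -- (i) similarity in the gauged class
    (∀ β β' : ℝ, β ≠ β' →
      (Kolmogorov.Similar (Kolmogorov.eqF' β) (Kolmogorov.eqF' β') ↔ β + β' = 5)) ∧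
    -- (ii) similarity in the original class
    (∀ α β α' β' : ℝ,
      (Kolmogorov.Similar (Kolmogorov.eqF (α, β)) (Kolmogorov.eqF (α', β')) ↔
        β' = β ∨ β + β' = 5)) ∧
    -- (iii) the groupoid of the original class is generated by the shifts to `α = 0` and by
    -- the groupoid of the gauged class
    ({A | Kolmogorov.Generated
        (Kolmogorov.shiftArrows ∪
          Kolmogorov.embed '' Kolmogorov.equivalenceGroupoid Kolmogorov.eqF') A} =
      Kolmogorov.equivalenceGroupoid Kolmogorov.eqF) ∧
    -- (iii) more specifically
    (∀ (α β α' β' : ℝ) (Φ : Kolmogorov.Trans),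
      ((α, β), Φ, (α', β')) ∈ Kolmogorov.equivalenceGroupoid Kolmogorov.eqF →
        ∃ Ψ : Kolmogorov.Trans,
          (β, Ψ, β') ∈ Kolmogorov.equivalenceGroupoid Kolmogorov.eqF' ∧
          Φ = (Kolmogorov.shift (-α)).trans (Ψ.trans (Kolmogorov.shift α'))) := by
  refine ⟨fun β β' hne => ⟨?_, fun h => ?_⟩, fun α β α' β' => ⟨?_, ?_⟩, Kolmogorov.generated_eq,
    fun α β α' β' Φ h => Kolmogorov.exists_gauged h⟩
  · rintro ⟨Φ, hΦ, h⟩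
    rw [Kolmogorov.eqF'_eq, Kolmogorov.eqF'_eq] at h
    exact (h.exponents hΦ).resolve_left hne.symm
  · rw [Kolmogorov.eqF'_eq, Kolmogorov.eqF'_eq]
    exact ⟨_, Kolmogorov.similar_gauged_of_add_eq h⟩
  · rintro ⟨Φ, hΦ, h⟩
    obtain ⟨Ψ, ⟨hΨ, h'⟩, -⟩ := Kolmogorov.exists_gauged (α := α) (α' := α') ⟨hΦ, h⟩
    rw [Kolmogorov.eqF'_eq, Kolmogorov.eqF'_eq] at h'
    exact h'.exponents hΨ
  · rintro (rfl | h)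
    · have := Kolmogorov.shift_mem (α' - α) α β'
      rw [add_sub_cancel] at this
      exact ⟨_, this⟩
    · have := Kolmogorov.conj_mem α α' (Kolmogorov.similar_gauged_of_add_eq h)
      rw [zero_add, zero_add] at this
      exact ⟨_, this⟩
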